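/- Let $(M,g)$ be a smooth pseudo-Riemannian manifold (Hausdorff, finite-dimensional, without boundary) with contravariant metric $G$ and Levi-Civita connection $\nabla$. Let $T$ be a smooth symmetric contravariant $2$-tensor field whose associated endomorphism of $TM$ is pointwise diagonalizable over $\mathbb{R}$, with smooth, pointwise distinct eigenfunctions $\lambda_1,\dots,\lambda_k$ (each an eigenvalue at every point) and eigenspaces $E_i=\ker(T-\lambda_i I)$, so that $TM$ is the orthogonal direct sum of $E_1,\dots,E_k$. Assume that the eigenspaces are orthogonally integrable: each point has a neighbourhood diffeomorphic to a product manifold $\prod_{i=1}^k M_i$ such that, for each $i$, the slices along $M_i$ are mapped to integral manifolds of $E_i$. For a vector field $x$ write $x=\sum_i x^i$ with $x^i\in\Gamma(E_i)$. For a nondegenerate distribution $E$ of rank $m$ and $X,Y\in\Gamma(E)$ let $s^E(X,Y)=(\nabla_XY)^{E^\perp}$, let $h^E$ be the symmetric part of $s^E$ and $H_E=\frac1m\operatorname{tr}h^E$ its mean curvature normal. $E$ is called geodesic if $s^E=0$; umbilical if $s^E(X,Y)=\langle X,Y\rangle H_E$ for all $X,Y\in\Gamma(E)$; spherical if it is umbilical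 and $(\nabla_XH_E)^{E^\perp}=0$ for all $X\in\Gamma(E)$; Killing if $E$ is spherical and $E^\perp$ is geodesic. Suppose that $T$ is a conformal Killing tensor with conformal factor the vector field $t$, i.e. $[T,G]=-2\,t\odot G$, where $[\cdot,\cdot]$ is the Schouten bracket, $[K,L]^{ijk}=2K^{l(i}\partial_lL^{jk)}-2L^{l(i}\partial_lK^{jk)}$, and $(t\odot G)^{ijk}=t^{(i}G^{jk)}$. Then for every $i$: 1. $E_i$ is Killing if and only if $(\nabla\lambda_j)^i=t^i$ for all $j\neq i$; 2. $E_i$ is geodesic if and only if $(\nabla\lambda_i)^j=t^j$ for all $j\neq i$. In particular, if $T$ is a Killing tensor (that is, $t=0$), then for every $i$: $E_i$ is Killing if and only if all the eigenfunctions $\lambda_1,\dots,\lambda_k$ are independent of $E_i$ (i.e. $d\lambda_j$ vanishes on $E_i$ for all $j$, including $j=i$); and $E_i$ is geodesic if and only if $\lambda_i$ is locally constant, hence, if $M$ is connected, if and only if $\lambda_i$ is constant. -/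

import Mathlib

open Bundle Set
open scoped Manifold ContDiff Topology

noncomputable section

namespace PseudoRiemannian

variable {E : Type*} [NormedAddCommGroup E] [NormedSpace ℝ E]
  {M : Type*} [TopologicalSpace M] [ChartedSpace E M]

/-! ### Tangent vectors, covectors, metrics and tensors -/

/-- The tangent space of `M` at `p`. -/
abbrev Tan (E : Type*) [NormedAddCommGroup E] [NormedSpace ℝ E]
    {M : Type*} [TopologicalSpace M] [ChartedSpace E M] (p : M) : Type _ :=
  TangentSpace 𝓘(ℝ, E) p

/-- The cotangent space of `M` at `p`. -/
abbrev Cotan (E : Type*) [NormedAddCommGroup E] [NormedSpace ℝ E]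
    {M : Type*} [TopologicalSpace M] [ChartedSpace E M] (p : M) : Type _ :=
  Tan E p →L[ℝ] ℝ

/-- The differential of a real function at `p`, as a covector. -/
abbrev diff (E : Type*) [NormedAddCommGroup E] [NormedSpace ℝ E]
    {M : Type*} [TopologicalSpace M] [ChartedSpace E M] (f : M → ℝ) (p : M) : Cotan E p :=
  mvfderiv 𝓘(ℝ, E) f p

/-- A smooth real function on `M`. -/
abbrev SmoothFun (E : Type*) [NormedAddCommGroup E] [NormedSpace ℝ E]
    {M : Type*} [TopologicalSpace M] [ChartedSpace E M] (f : M → ℝ) : Prop :=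
  ContMDiff 𝓘(ℝ, E) 𝓘(ℝ, ℝ) ∞ f

instance (p : M) [FiniteDimensional ℝ E] : FiniteDimensional ℝ (Tan E p) :=
  inferInstanceAs (FiniteDimensional ℝ E)

instance (p : M) : T2Space (Tan E p) :=
  inferInstanceAs (T2Space E)

variable [IsManifold 𝓘(ℝ, E) ∞ M]

/-- A smooth vector field on `M`. -/
abbrev SmoothField (X : ∀ p : M, Tan E p) : Prop :=
  ContMDiff 𝓘(ℝ, E) (𝓘(ℝ, E).prod 𝓘(ℝ, E)) ∞
    (fun p => TotalSpace.mk' E p (X p) : M → TotalSpace E (TangentSpace 𝓘(ℝ, E) : M → Type _))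

/-- The vector field `X` is differentiable at `p`. -/
abbrev DiffFieldAt (X : ∀ p : M, Tan E p) (p : M) : Prop :=
  MDifferentiableAt 𝓘(ℝ, E) (𝓘(ℝ, E).prod 𝓘(ℝ, E))
    (fun q => TotalSpace.mk' E q (X q) : M → TotalSpace E (TangentSpace 𝓘(ℝ, E) : M → Type _)) p

variable (E M) in
/-- A smooth pseudo-Riemannian metric: a smooth, symmetric, nondegenerate covariant `2`-tensor
field of arbitrary signature. -/
structure Metric where
  /-- The scalar product on the tangent space at `p`. -/
  val (p : M) : Tan E p →L[ℝ] Tan E p →L[ℝ] ℝ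
  symm (p : M) (v w : Tan E p) : val p v w = val p w v
  nondegenerate (p : M) (v : Tan E p) : (∀ w, val p v w = 0) → v = 0
  smooth : ContMDiff 𝓘(ℝ, E) (𝓘(ℝ, E).prod 𝓘(ℝ, E →L[ℝ] E →L[ℝ] ℝ)) ∞
    (fun p => TotalSpace.mk' (E →L[ℝ] E →L[ℝ] ℝ) p (val p) : M → TotalSpace (E →L[ℝ] E →L[ℝ] ℝ)
      (fun p : M => TangentSpace 𝓘(ℝ, E) p →L[ℝ] TangentSpace 𝓘(ℝ, E) p →L[ℝ] ℝ))

variable (E M) in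
/-- A smooth symmetric contravariant `2`-tensor field `T`. The bilinear form `T_p` on covectors is
stored as the linear map `α ↦ T_p(α, ·)` from the cotangent space to its dual, the tangent space;
thus `T_p(α, β) = β (val p α)`. -/
structure SymTensor where
  /-- The linear map `α ↦ T_p(α, ·)`. -/
  val (p : M) : Cotan E p →L[ℝ] Tan E p
  symm (p : M) (α β : Cotan E p) : β (val p α) = α (val p β)
  smooth : ContMDiff 𝓘(ℝ, E) (𝓘(ℝ, E).prod 𝓘(ℝ, (E →L[ℝ] ℝ) →L[ℝ] E)) ∞
    (fun p => TotalSpace.mk' ((E →L[ℝ] ℝ) →L[ℝ] E) p (val p) :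
      M → TotalSpace ((E →L[ℝ] ℝ) →L[ℝ] E)
        (fun p : M => (TangentSpace 𝓘(ℝ, E) p →L[ℝ] ℝ) →L[ℝ] TangentSpace 𝓘(ℝ, E) p))

namespace Metric

variable (g : Metric E M)

theorem flat_injective (p : M) : Function.Injective (g.val p) := by
  rw [injective_iff_map_eq_zero]
  intro v hv
  exact g.nondegenerate p v fun w => by simp [hv]

variable [FiniteDimensional ℝ E]

/-- The musical isomorphism `v ↦ ⟨v, ·⟩`. -/
def flat (p : M) : Tan E p ≃ₗ[ℝ] Cotan E p :=
  LinearEquiv.ofInjectiveOfFinrankEq (g.val p).toLinearMap (g.flat_injective p) (by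
    rw [← LinearEquiv.finrank_eq (LinearMap.toContinuousLinearMap (𝕜 := ℝ) (E := Tan E p) (F' := ℝ))]
    exact (Subspace.dual_finrank_eq).symm)

/-- The contravariant metric, as a map from covectors to vectors: the inverse of `flat`. -/
def sharp (p : M) : Cotan E p →L[ℝ] Tan E p :=
  LinearMap.toContinuousLinearMap (g.flat p).symm.toLinearMap

theorem val_sharp (p : M) (α : Cotan E p) (v : Tan E p) : g.val p (g.sharp p α) v = α v := by
  have h : g.flat p (g.sharp p α) = α := (g.flat p).apply_symm_apply α
  exact DFunLike.congr_fun h v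

/-- The gradient `∇ f`. -/
def grad (f : M → ℝ) (p : M) : Tan E p := g.sharp p (diff E f p)

end Metric

/-! ### The Levi-Civita connection -/

section LeviCivita

variable (g : Metric E M)

/-- The right hand side `⟨∇_X Y, Z⟩` of the Koszul formula. -/
def koszul (X Y Z : ∀ p : M, Tan E p) (p : M) : ℝ :=
  (1 / 2 : ℝ) *
    (diff E (fun q => g.val q (Y q) (Z q)) p (X p)
      + diff E (fun q => g.val q (Z q) (X q)) p (Y p)
      - diff E (fun q => g.val q (X q) (Y q)) p (Z p)
      + g.val p (VectorField.mlieBracket 𝓘(ℝ, E) X Y p) (Z p)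
      - g.val p (VectorField.mlieBracket 𝓘(ℝ, E) Y Z p) (X p)
      + g.val p (VectorField.mlieBracket 𝓘(ℝ, E) Z X p) (Y p))

variable {g}

theorem mdifferentiableAt_metric {X Y : ∀ p : M, Tan E p} {p : M}
    (hX : DiffFieldAt X p) (hY : DiffFieldAt Y p) :
    MDifferentiableAt 𝓘(ℝ, E) 𝓘(ℝ, ℝ) (fun q => g.val q (X q) (Y q)) p := by
  have h : MDifferentiableAt 𝓘(ℝ, E) (𝓘(ℝ, E).prod 𝓘(ℝ))
      (fun m ↦ TotalSpace.mk' ℝ (E := Bundle.Trivial M ℝ) m (g.val m (X m) (Y m))) p :=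
    MDifferentiableAt.clm_bundle_apply₂ (F₁ := E) (F₂ := E)
      (E₁ := (TangentSpace 𝓘(ℝ, E) : M → Type _)) (E₂ := (TangentSpace 𝓘(ℝ, E) : M → Type _))
      (g.smooth.mdifferentiable (by simp) p) hX hY
  rw [mdifferentiableAt_totalSpace] at h
  exact h.2

theorem eq_of_forall_field {p : M} {v w : Tan E p}
    (h : ∀ Z : ∀ p : M, Tan E p, DiffFieldAt Z p → g.val p v (Z p) = g.val p w (Z p)) : v = w := by
  refine g.flat_injective p (ContinuousLinearMap.ext fun z => ?_)
  have := h (FiberBundle.extend E z) (FiberBundle.mdifferentiableAt_extend ..)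
  simpa using this

variable [FiniteDimensional ℝ E]

/-- The Koszul expression depends on `Z` only through its value at the point. -/
theorem tensorialAt_koszul {X Y : ∀ p : M, Tan E p} {p : M}
    (hX : DiffFieldAt X p) (hY : DiffFieldAt Y p) :
    TensorialAt 𝓘(ℝ, E) E (fun Z => koszul g X Y Z p) p where
  smul {f Z} hf hZ := by
    have hYZ := mdifferentiableAt_metric (g := g) hY hZ
    have hZX := mdifferentiableAt_metric (g := g) hZ hX
    simp only [koszul, diff, Pi.smul_apply', map_smul, smul_apply, smul_eq_mul]
    rw [VectorField.mlieBracket_smul_right hf hZ, VectorField.mlieBracket_smul_left hf hZ]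
    have e1 := mvfderiv_mul hf hYZ
    have e2 := mvfderiv_mul hf hZX
    simp only [Pi.mul_def] at e1 e2
    rw [e1, e2]
    simp only [map_add, map_smul, add_apply, smul_apply,
      smul_eq_mul, map_neg, neg_apply, neg_smul]
    rw [g.symm p (Y p) (Z p)]
    ring
  add {Z W} hZ hW := by
    have hYZ := mdifferentiableAt_metric (g := g) hY hZ
    have hZX := mdifferentiableAt_metric (g := g) hZ hX
    have hYW := mdifferentiableAt_metric (g := g) hY hW
    have hWX := mdifferentiableAt_metric (g := g) hW hX
    simp only [koszul, diff, Pi.add_apply, map_add, add_apply]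
    rw [VectorField.mlieBracket_add_right hZ hW, VectorField.mlieBracket_add_left hZ hW]
    have e1 := mvfderiv_add hYZ hYW
    have e2 := mvfderiv_add hZX hWX
    simp only [Pi.add_def] at e1 e2
    rw [e1, e2]
    simp only [map_add, add_apply]
    ring

open Classical in
variable (g) in
/-- The Levi-Civita derivative `∇_X Y`: the vector field determined by the Koszul formula. It is
meaningful at the points where `X` and `Y` are differentiable. -/
def nabla (X Y : ∀ p : M, Tan E p) (p : M) : Tan E p :=
  if h : TensorialAt 𝓘(ℝ, E) E (fun Z => koszul g X Y Z p) p then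
    g.sharp p (TensorialAt.mkHom (fun Z => koszul g X Y Z p) p h)
  else 0

theorem nabla_koszul {X Y Z : ∀ p : M, Tan E p} {p : M}
    (hX : DiffFieldAt X p) (hY : DiffFieldAt Y p) (hZ : DiffFieldAt Z p) :
    g.val p (nabla g X Y p) (Z p) = koszul g X Y Z p := by
  rw [nabla, dif_pos (tensorialAt_koszul hX hY), g.val_sharp]
  exact TensorialAt.mkHom_apply (tensorialAt_koszul hX hY) hZ

theorem nabla_torsion_free {X Y : ∀ p : M, Tan E p} {p : M}
    (hX : DiffFieldAt X p) (hY : DiffFieldAt Y p) :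
    nabla g X Y p - nabla g Y X p = VectorField.mlieBracket 𝓘(ℝ, E) X Y p := by
  refine eq_of_forall_field (g := g) fun Z hZ => ?_
  have hc : ∀ A B : ∀ p : M, Tan E p,
      (fun q => g.val q (A q) (B q)) = fun q => g.val q (B q) (A q) :=
    fun A B => funext fun q => g.symm q _ _
  rw [map_sub, sub_apply, nabla_koszul hX hY hZ, nabla_koszul hY hX hZ, koszul,
    koszul, hc X Z, hc Z Y, hc Y X, VectorField.mlieBracket_swap_apply (V := Y) (W := X),
    VectorField.mlieBracket_swap_apply (V := X) (W := Z),
    VectorField.mlieBracket_swap_apply (V := Z) (W := Y)]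
  simp only [map_neg, neg_apply]
  ring

theorem nabla_metric {X Y Z : ∀ p : M, Tan E p} {p : M}
    (hX : DiffFieldAt X p) (hY : DiffFieldAt Y p) (hZ : DiffFieldAt Z p) :
    diff E (fun q => g.val q (Y q) (Z q)) p (X p)
      = g.val p (nabla g X Y p) (Z p) + g.val p (Y p) (nabla g X Z p) := by
  have hc : ∀ A B : ∀ p : M, Tan E p,
      (fun q => g.val q (A q) (B q)) = fun q => g.val q (B q) (A q) :=
    fun A B => funext fun q => g.symm q _ _
  rw [g.symm p (Y p), nabla_koszul hX hY hZ, nabla_koszul hX hZ hY, koszul,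
    koszul, hc X Z, hc Z Y, hc Y X, VectorField.mlieBracket_swap_apply (V := Y) (W := X),
    VectorField.mlieBracket_swap_apply (V := X) (W := Z),
    VectorField.mlieBracket_swap_apply (V := Z) (W := Y)]
  simp only [map_neg, neg_apply]
  ring

end LeviCivita

/-! ### Distributions -/

section Distributions

/-- A field of tangent subspaces. -/
abbrev Dist (E : Type*) [NormedAddCommGroup E] [NormedSpace ℝ E]
    (M : Type*) [TopologicalSpace M] [ChartedSpace E M] : Type _ :=
  ∀ p : M, Submodule ℝ (Tan E p)

/-- `X` is a smooth section of `D`, i.e. `X ∈ Γ(D)`. -/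
def IsSection (D : Dist E M) (X : ∀ p : M, Tan E p) : Prop :=
  SmoothField X ∧ ∀ p, X p ∈ D p

variable (g : Metric E M)

/-- The scalar product at `p` as a bilinear form. -/
def Metric.bilin (p : M) : LinearMap.BilinForm ℝ (Tan E p) :=
  LinearMap.mk₂ ℝ (fun v w => g.val p v w) (by simp) (by simp) (by simp) (by simp)

/-- The orthogonal distribution `D^⊥`. -/
def perp (D : Dist E M) : Dist E M := fun p => (g.bilin p).orthogonal (D p)

/-- `D` is nondegenerate: the restriction of the metric to `D` is nondegenerate at each point. -/
def IsNondegenerate (D : Dist E M) : Prop :=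
  ∀ p, ∀ v ∈ D p, (∀ w ∈ D p, g.val p v w = 0) → v = 0

open Classical in
/-- The orthogonal projection `v ↦ v^D` of the splitting `TM = D ⊕ D^⊥`, for nondegenerate `D`. -/
def proj (D : Dist E M) (p : M) : Tan E p →ₗ[ℝ] Tan E p :=
  if h : IsCompl (D p) (perp g D p) then Submodule.projection (D p) (perp g D p) h else 0

variable [FiniteDimensional ℝ E]

/-- The generalized second fundamental form `s^D(X, Y) = (∇_X Y)^{D^⊥}`. -/
def secondForm (D : Dist E M) (X Y : ∀ p : M, Tan E p) (p : M) : Tan E p :=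
  proj g (perp g D) p (nabla g X Y p)

/-- The symmetric part `h^D(X, Y)` of `s^D(X, Y)`. -/
def symSecondForm (D : Dist E M) (X Y : ∀ p : M, Tan E p) (p : M) : Tan E p :=
  (1 / 2 : ℝ) • (secondForm g D X Y p + secondForm g D Y X p)

/-- `H` is the mean curvature normal of `D`: the section of `D^⊥` that satisfies
`m • H = tr h^D`, where `m` is the rank of `D`. The trace is taken in arbitrary orthogonal bases of
`D_p` that are made of values of sections of `D`. -/
structure IsMeanCurvatureNormal (D : Dist E M) (H : ∀ p : M, Tan E p) : Prop where
  isSection : IsSection (perp g D) H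
  trace_eq : ∀ (p : M) (X : Fin (Module.finrank ℝ (D p)) → ∀ q : M, Tan E q),
    (∀ a, IsSection D (X a)) →
    (∀ a b, a ≠ b → g.val p (X a p) (X b p) = 0) →
    (∀ a, g.val p (X a p) (X a p) ≠ 0) →
    (Module.finrank ℝ (D p) : ℝ) • H p =
      ∑ a, (g.val p (X a p) (X a p))⁻¹ • symSecondForm g D (X a) (X a) p

/-- `D` is geodesic: `s^D(X, Y) = 0` for all `X, Y ∈ Γ(D)`. -/
structure IsGeodesic (D : Dist E M) : Prop where
  nondegenerate : IsNondegenerate g D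
  secondForm_eq : ∀ X Y, IsSection D X → IsSection D Y → ∀ p, secondForm g D X Y p = 0

/-- `D` is umbilical with mean curvature normal `H`: `s^D(X, Y) = ⟨X, Y⟩ H` for all
`X, Y ∈ Γ(D)`. -/
structure IsUmbilicalWith (D : Dist E M) (H : ∀ p : M, Tan E p) : Prop where
  nondegenerate : IsNondegenerate g D
  meanCurvature : IsMeanCurvatureNormal g D H
  secondForm_eq : ∀ X Y, IsSection D X → IsSection D Y →
    ∀ p, secondForm g D X Y p = g.val p (X p) (Y p) • H p

/-- `D` is spherical: `D` is umbilical and its mean curvature normal `H` satisfies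
`(∇_X H)^{D^⊥} = 0` for all `X ∈ Γ(D)`. -/
def IsSpherical (D : Dist E M) : Prop :=
  ∃ H : ∀ p : M, Tan E p, IsUmbilicalWith g D H ∧
    ∀ X, IsSection D X → ∀ p, proj g (perp g D) p (nabla g X H p) = 0

/-- `D` is Killing: `D` is spherical and `D^⊥` is geodesic. -/
def IsKilling (D : Dist E M) : Prop :=
  IsSpherical g D ∧ IsGeodesic g (perp g D)

end Distributions

/-- The function `f` is independent of the distribution `D`: `df` vanishes on `D`. -/
def IndependentOf (f : M → ℝ) (D : Dist E M) : Prop :=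
  ∀ p, ∀ v ∈ D p, diff E f p v = 0

/-- The family `(D i)` is locally a product: around each point there are local coordinates with
values in a product of open sets `U i` of Euclidean spaces, in which `D i` is tangent to the slices
along the `i`-th factor. Equivalently, a neighbourhood of each point is diffeomorphic to a product
manifold whose slices are integral manifolds of the `D i`. -/
def IsLocallyProduct {ι : Type*} [Fintype ι] (D : ι → Dist E M) : Prop :=
  ∀ p : M, ∃ (d : ι → ℕ)
    (φ : OpenPartialHomeomorph M (∀ i, EuclideanSpace ℝ (Fin (d i))))
    (U : ∀ i, Set (EuclideanSpace ℝ (Fin (d i)))),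
    p ∈ φ.source ∧ (∀ i, IsOpen (U i)) ∧ φ.target = Set.univ.pi U ∧
    ContMDiffOn 𝓘(ℝ, E) 𝓘(ℝ, ∀ i, EuclideanSpace ℝ (Fin (d i))) ∞ φ φ.source ∧
    ContMDiffOn 𝓘(ℝ, ∀ i, EuclideanSpace ℝ (Fin (d i))) 𝓘(ℝ, E) ∞ φ.symm φ.target ∧
    ∀ q ∈ φ.source, ∀ i, ∀ v : Tan E q,
      v ∈ D i q ↔ ∀ j, j ≠ i → mvfderiv 𝓘(ℝ, E) (fun x => φ x j) q v = 0

/-- The family `(D i)` is orthogonally integrable: it consists of nondegenerate distributions, `TM`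
is their orthogonal direct sum, and it is locally a product. -/
structure IsOrthogonallyIntegrable {ι : Type*} [Fintype ι] (g : Metric E M) (D : ι → Dist E M) :
    Prop where
  nondegenerate : ∀ i, IsNondegenerate g (D i)
  orthogonal : ∀ p i j, i ≠ j → ∀ v ∈ D i p, ∀ w ∈ D j p, g.val p v w = 0
  independent : ∀ p, iSupIndep fun i => D i p
  span : ∀ p, ⨆ i, D i p = ⊤
  product : IsLocallyProduct D

/-! ### Conformal Killing tensors -/

section Killing

/-- The Schouten bracket `[K, L]` of two symmetric contravariant `2`-tensor fields, evaluated on the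
differentials of three functions. In local coordinates it is the symmetrization of
`2 K^{il} ∂_l L^{jk} - 2 L^{il} ∂_l K^{jk}`: the terms with second derivatives of the functions
cancel. -/
def schouten (K L : ∀ p : M, Cotan E p →L[ℝ] Tan E p) (f₁ f₂ f₃ : M → ℝ) (p : M) : ℝ :=
  let term (a b c : M → ℝ) : ℝ :=
    2 * diff E (fun q => diff E c q (L q (diff E b q))) p (K p (diff E a p))
      - 2 * diff E (fun q => diff E c q (K q (diff E b q))) p (L p (diff E a p))
  (1 / 3 : ℝ) * (term f₁ f₂ f₃ + term f₂ f₃ f₁ + term f₃ f₁ f₂)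

/-- The symmetric product `C ⊙ L` of a vector and a symmetric contravariant `2`-tensor at `p`. -/
def symProd {p : M} (C : Tan E p) (L : Cotan E p →L[ℝ] Tan E p) (α β γ : Cotan E p) : ℝ :=
  (1 / 3 : ℝ) * (α C * γ (L β) + β C * α (L γ) + γ C * β (L α))

variable [FiniteDimensional ℝ E] (g : Metric E M) (T : SymTensor E M)

/-- `T` is a conformal Killing tensor with conformal factor `t`: `[T, G] = -2 t ⊙ G`, where `G` is
the contravariant metric. -/
structure IsConformalKilling (t : ∀ p : M, Tan E p) : Prop where
  smooth : SmoothField t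
  schouten_eq : ∀ f₁ f₂ f₃ : M → ℝ, SmoothFun E f₁ → SmoothFun E f₂ → SmoothFun E f₃ → ∀ p,
    schouten T.val g.sharp f₁ f₂ f₃ p =
      -2 * symProd (t p) (g.sharp p) (diff E f₁ p) (diff E f₂ p) (diff E f₃ p)

/-- `T` is a Killing tensor: a conformal Killing tensor with conformal factor zero. -/
def IsKillingTensor : Prop := IsConformalKilling g T 0

/-- The endomorphism of the tangent space determined by `T`: lower an index, then apply `T`. -/
def SymTensor.endo (p : M) : Module.End ℝ (Tan E p) :=
  (T.val p).toLinearMap ∘ₗ (g.flat p).toLinearMap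

/-- The eigenspace distribution `ker (T - μ I)` of a function `μ`. -/
def eigenDist (μ : M → ℝ) : Dist E M := fun p => Module.End.eigenspace (T.endo g p) (μ p)

/-- `T` is an orthogonal tensor (its endomorphism is pointwise diagonalizable with real eigenvalues)
whose eigenfunctions are the smooth functions `lam i`: at each point these are its eigenvalues,
each listed once. -/
structure IsOrthogonalTensor {ι : Type*} (lam : ι → M → ℝ) : Prop where
  smooth : ∀ i, SmoothFun E (lam i)
  distinct : ∀ p i j, i ≠ j → lam i p ≠ lam j p
  eigenvalue : ∀ p i, Module.End.HasEigenvalue (T.endo g p) (lam i p)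
  diagonalizable : ∀ p, ⨆ i, eigenDist g T (lam i) p = ⊤

end Killing

end PseudoRiemannian

end

namespace PseudoRiemannian

variable {E : Type*} [NormedAddCommGroup E] [NormedSpace ℝ E]
  {M : Type*} [TopologicalSpace M] [ChartedSpace E M]

/-! Evaluated on differentials of functions, `[T, G] = -2 t ⊙ G` says that the cyclic sum of `(∇_X
T)(Y, Z)` equals the cyclic sum of `⟨t, X⟩⟨Y, Z⟩` (`covT_cyclic`). For `Y ∈ Γ(E_j)` and `Z ∈ Γ(E_k)`
one has `(∇_X T)(Y, Z) = X(λ_j)⟨Y, Z⟩ + (λ_j - λ_k)⟨∇_X Y, Z⟩` (`covT_of_sections`), so the cyclic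
identity relates eigenfunctions and second fundamental forms.

With all arguments in `E_i` it gives `dλ_i = ⟨t, ·⟩` on `E_i` (`diff_eq_of_mem_eigenDist`). With `X,
Y` in `E_i` and `Z` in `E_j`, integrability makes `⟨∇_X Y, Z⟩` symmetric in `X, Y`, and the result
is `2(λ_i - λ_j)⟨∇_X Y, Z⟩ = (⟨t, Z⟩ - dλ_i(Z))⟨X, Y⟩` (`val_nabla_of_conformalKilling`). So every
`E_i` is umbilical with an explicit normal `H`, and it is geodesic exactly when `dλ_i` agrees with
`⟨t, ·⟩` on the other eigenspaces.

Applied to `E_j` instead, the same formula shows that `E_i^⊥` geodesic forces `dλ_j = ⟨t, ·⟩` on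
`E_i`. Conversely, that condition kills `⟨∇_X Y, Z⟩` for `X, Y` in one `E_j` and `Z` in `E_i`; for
three distinct eigenspaces the Koszul formula gives zero because the product structure controls all
brackets. Sphericity then follows: with `f = λ_i - λ_j`, `f` is constant along `E_i` and `f⟨H, Z⟩ =
-½ Z(f)` on `E_j`; differentiating along `E_i` gives `⟨∇_X H, Z⟩ = 0`. The Killing tensor statements
are the case `t = 0`, where `dλ_i` already vanishes on `E_i`. -/

theorem mvfderiv_congr {F : Type*} [NormedAddCommGroup F] [NormedSpace ℝ F]
    {f f' : M → F} {p : M} (h : f =ᶠ[𝓝 p] f') :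
    mvfderiv 𝓘(ℝ, E) f p = mvfderiv 𝓘(ℝ, E) f' p := by
  ext v
  simp only [mvfderiv]
  rw [h.mfderiv_eq, h.eq_of_nhds]

/-! ### Lie brackets as commutators of derivatives -/

section Bracket

variable [IsManifold 𝓘(ℝ, E) ∞ M]
  {F : Type*} [NormedAddCommGroup F] [NormedSpace ℝ F]

theorem mdifferentiableAt_extChartAt_symm_self {p : M} {y : E}
    (hy : y ∈ (extChartAt 𝓘(ℝ, E) p).target) :
    MDifferentiableAt 𝓘(ℝ, E) 𝓘(ℝ, E) (extChartAt 𝓘(ℝ, E) p).symm y := by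
  have := mdifferentiableWithinAt_extChartAt_symm (I := 𝓘(ℝ, E)) hy
  rwa [modelWithCornersSelf_coe, range_id, mdifferentiableWithinAt_univ] at this

theorem fderiv_comp_extChartAt_symm {f : M → F} {p : M} {y : E}
    (hy : y ∈ (extChartAt 𝓘(ℝ, E) p).target)
    (hf : MDifferentiableAt 𝓘(ℝ, E) 𝓘(ℝ, F) f ((extChartAt 𝓘(ℝ, E) p).symm y)) (v : E) :
    fderiv ℝ (f ∘ (extChartAt 𝓘(ℝ, E) p).symm) y v =
      mvfderiv 𝓘(ℝ, E) f ((extChartAt 𝓘(ℝ, E) p).symm y)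
        (mfderiv 𝓘(ℝ, E) 𝓘(ℝ, E) (extChartAt 𝓘(ℝ, E) p).symm y v) := by
  rw [← mfderiv_eq_fderiv, mfderiv_comp y hf (mdifferentiableAt_extChartAt_symm_self hy)]
  rfl

/-- The derivative along a Lie bracket is the commutator of the derivatives. -/
theorem mvfderiv_mlieBracket [CompleteSpace E] {f : M → F} {X Y : ∀ p : M, Tan E p} {p : M}
    (hf : ContMDiffAt 𝓘(ℝ, E) 𝓘(ℝ, F) ∞ f p)
    (hfX : MDifferentiableAt 𝓘(ℝ, E) 𝓘(ℝ, F) (fun q => mvfderiv 𝓘(ℝ, E) f q (X q)) p)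
    (hfY : MDifferentiableAt 𝓘(ℝ, E) 𝓘(ℝ, F) (fun q => mvfderiv 𝓘(ℝ, E) f q (Y q)) p)
    (hX : DiffFieldAt X p) (hY : DiffFieldAt Y p) :
    mvfderiv 𝓘(ℝ, E) f p (VectorField.mlieBracket 𝓘(ℝ, E) X Y p) =
      mvfderiv 𝓘(ℝ, E) (fun q => mvfderiv 𝓘(ℝ, E) f q (Y q)) p (X p) -
        mvfderiv 𝓘(ℝ, E) (fun q => mvfderiv 𝓘(ℝ, E) f q (X q)) p (Y p) := by
  have : IsManifold 𝓘(ℝ, E) (minSmoothness ℝ 2) M := by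
    rw [minSmoothness_of_isRCLikeNormedField]; infer_instance
  have hn : minSmoothness ℝ 2 ≤ ∞ := by
    rw [minSmoothness_of_isRCLikeNormedField]
    exact WithTop.coe_le_coe.2 (le_top : (2 : ℕ∞) ≤ ⊤)
  set φ := extChartAt 𝓘(ℝ, E) p with hφ
  have hpt : φ p ∈ φ.target := mem_extChartAt_target p
  have hpp : φ.symm (φ p) = p := extChartAt_to_inv p
  have htn : φ.target ∈ 𝓝 (φ p) := extChartAt_target_mem_nhds p
  have hinv : ∀ y ∈ φ.target, (mfderiv 𝓘(ℝ, E) 𝓘(ℝ, E) φ.symm y).IsInvertible := by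
    intro y hy
    have := isInvertible_mfderivWithin_extChartAt_symm (I := 𝓘(ℝ, E)) hy
    rwa [modelWithCornersSelf_coe, range_id, mfderivWithin_univ] at this
  have hφs : ContMDiffAt 𝓘(ℝ, E) 𝓘(ℝ, E) ∞ φ.symm (φ p) := by
    have := contMDiffWithinAt_extChartAt_symm_range (I := 𝓘(ℝ, E)) (n := ∞) p hpt
    rwa [modelWithCornersSelf_coe, range_id, contMDiffWithinAt_univ] at this
  -- Fields are pulled back through the inverse chart to the model space, where symmetry of the
  -- second derivative gives the identity; `hbr`, `hfirst` and `hsecond` carry its terms back to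
  -- `M`.
  let pb (Z : ∀ p : M, Tan E p) : E → E := VectorField.mpullback 𝓘(ℝ, E) 𝓘(ℝ, E) φ.symm Z
  have hpb : ∀ {Z : ∀ p : M, Tan E p}, ∀ y ∈ φ.target,
      mfderiv 𝓘(ℝ, E) 𝓘(ℝ, E) φ.symm y (pb Z y) = Z (φ.symm y) := by
    intro Z y hy
    simp only [pb, VectorField.mpullback_apply]
    exact (hinv y hy).self_apply_inverse _
  have hdiff : ∀ {Z : ∀ p : M, Tan E p}, DiffFieldAt Z p → DifferentiableAt ℝ (pb Z) (φ p) := by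
    intro Z hZ
    have := MDifferentiableWithinAt.differentiableWithinAt_mpullbackWithin_vectorField
      (I := 𝓘(ℝ, E)) (s := univ) (V := Z) (x := p) (by rwa [mdifferentiableWithinAt_univ])
    rw [modelWithCornersSelf_coe, range_id, preimage_univ, univ_inter,
      VectorField.mpullbackWithin_univ] at this
    exact differentiableWithinAt_univ.1 this
  let w : E := VectorField.lieBracket ℝ (pb X) (pb Y) (φ p)
  have hbr : mfderiv 𝓘(ℝ, E) 𝓘(ℝ, E) φ.symm (φ p) w =
      VectorField.mlieBracket 𝓘(ℝ, E) X Y (φ.symm (φ p)) := by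
    have h := VectorField.mpullback_mlieBracket (I := 𝓘(ℝ, E)) (I' := 𝓘(ℝ, E)) (f := φ.symm)
      (x₀ := φ p) (V := X) (W := Y) (n := ∞) (by rw [hpp]; exact hX) (by rw [hpp]; exact hY) hφs
      hn
    have h2 : VectorField.mlieBracket 𝓘(ℝ, E) (pb X) (pb Y) (φ p) = w := by
      have := VectorField.mlieBracketWithin_eq_lieBracketWithin (𝕜 := ℝ) (V := pb X) (W := pb Y)
        (s := univ)
      rw [VectorField.lieBracketWithin_univ] at this
      exact congrFun this _
    rw [← h2]
    refine Eq.trans (congrArg _ h.symm) ?_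
    exact hpb (Z := VectorField.mlieBracket 𝓘(ℝ, E) X Y) _ hpt
  have hfd : ∀ᶠ y in 𝓝 (φ p), MDifferentiableAt 𝓘(ℝ, E) 𝓘(ℝ, F) f (φ.symm y) := by
    have h1 : ∀ᶠ q in 𝓝 p, ContMDiffAt 𝓘(ℝ, E) 𝓘(ℝ, F) 1 f q :=
      (contMDiffAt_iff_contMDiffAt_nhds (by simp)).1
        (hf.of_le (by exact mod_cast (le_top : (1 : ℕ∞) ≤ ⊤)))
    have h2 : Filter.Tendsto φ.symm (𝓝 (φ p)) (𝓝 p) := by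
      have := hφs.continuousAt
      rwa [ContinuousAt, hpp] at this
    filter_upwards [h2.eventually h1] with y hy
    exact hy.mdifferentiableAt one_ne_zero
  have hcd : ContDiffAt ℝ ∞ (f ∘ φ.symm) (φ p) := by
    rw [← contMDiffAt_iff_contDiffAt]
    refine ContMDiffAt.comp _ ?_ hφs
    rwa [hpp]
  have hfirst : ∀ Z : ∀ p : M, Tan E p,
      (fun y => fderiv ℝ (f ∘ φ.symm) y (pb Z y)) =ᶠ[𝓝 (φ p)]
        (fun q => mvfderiv 𝓘(ℝ, E) f q (Z q)) ∘ φ.symm := by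
    intro Z
    filter_upwards [hfd, htn] with y hy hyt
    rw [fderiv_comp_extChartAt_symm hyt hy, hpb y hyt]
    rfl
  have hsecond : ∀ Z Z' : ∀ p : M, Tan E p,
      MDifferentiableAt 𝓘(ℝ, E) 𝓘(ℝ, F) (fun q => mvfderiv 𝓘(ℝ, E) f q (Z q)) p →
      fderiv ℝ (fun y => fderiv ℝ (f ∘ φ.symm) y (pb Z y)) (φ p) (pb Z' (φ p)) =
        mvfderiv 𝓘(ℝ, E) (fun q => mvfderiv 𝓘(ℝ, E) f q (Z q)) (φ.symm (φ p))
          (Z' (φ.symm (φ p))) := by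
    intro Z Z' hZ
    rw [(hfirst Z).fderiv_eq, fderiv_comp_extChartAt_symm hpt (by rwa [hpp]), hpb _ hpt]
  have key := VectorField.fderiv_apply_lieBracket (𝕜 := ℝ) hcd (V := pb X) (W := pb Y)
    hn (hdiff hY) (hdiff hX)
  rw [fderiv_comp_extChartAt_symm hpt hfd.self_of_nhds, hbr, hsecond Y X hfY, hsecond X Y hfX]
    at key
  rwa [hpp] at key

end Bracket

/-! ### Smoothness of fields, gradients and functions with prescribed differential -/

section Smooth

variable [IsManifold 𝓘(ℝ, E) ∞ M]
  {F : Type*} [NormedAddCommGroup F] [NormedSpace ℝ F]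

/-- The vector field `X` is smooth at `p`. -/
abbrev SmoothFieldAt (X : ∀ p : M, Tan E p) (p : M) : Prop :=
  ContMDiffAt 𝓘(ℝ, E) (𝓘(ℝ, E).prod 𝓘(ℝ, E)) ∞
    (fun q => TotalSpace.mk' E q (X q) : M → TotalSpace E (TangentSpace 𝓘(ℝ, E) : M → Type _)) p

theorem SmoothFieldAt.diff {X : ∀ p : M, Tan E p} {p : M} (h : SmoothFieldAt X p) :
    DiffFieldAt X p :=
  ContMDiffAt.mdifferentiableAt h (by simp)

theorem SmoothField.diff {X : ∀ p : M, Tan E p} (h : SmoothField X) (p : M) :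
    DiffFieldAt X p :=
  (h p).mdifferentiableAt (by simp)

theorem contMDiffAt_mvfderiv_apply {f : M → F} {X : ∀ p : M, Tan E p} {p : M}
    (hf : ContMDiffAt 𝓘(ℝ, E) 𝓘(ℝ, F) ∞ f p) (hX : SmoothFieldAt X p) :
    ContMDiffAt 𝓘(ℝ, E) 𝓘(ℝ, F) ∞ (fun q => mvfderiv 𝓘(ℝ, E) f q (X q)) p := by
  have h1 := hf.mfderiv_const (m := ∞) (by simp)
  have h2 := ContMDiffAt.clm_apply_of_inCoordinates (b₁ := id) (b₂ := f) (v := X)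
    (ϕ := fun q => mfderiv 𝓘(ℝ, E) 𝓘(ℝ, F) f q) h1 hX hf
  exact (contMDiff_snd_tangentBundle_modelSpace F 𝓘(ℝ, F)).contMDiffAt.comp p h2

theorem contMDiffAt_metric (g : Metric E M) {X Y : ∀ p : M, Tan E p} {p : M}
    (hX : SmoothFieldAt X p) (hY : SmoothFieldAt Y p) :
    ContMDiffAt 𝓘(ℝ, E) 𝓘(ℝ, ℝ) ∞ (fun q => g.val q (X q) (Y q)) p := by
  have h : ContMDiffAt 𝓘(ℝ, E) (𝓘(ℝ, E).prod 𝓘(ℝ)) ∞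
      (fun m ↦ TotalSpace.mk' ℝ (E := Bundle.Trivial M ℝ) m (g.val m (X m) (Y m))) p :=
    ContMDiffAt.clm_bundle_apply₂ (F₁ := E) (F₂ := E)
      (E₁ := (TangentSpace 𝓘(ℝ, E) : M → Type _)) (E₂ := (TangentSpace 𝓘(ℝ, E) : M → Type _))
      (g.smooth p) hX hY
  rw [contMDiffAt_totalSpace] at h
  exact h.2

/-- In a trivialization the metric becomes a smooth family `A q` of invertible maps, and the
coordinates of `Y` solve a linear system `A q · Y = ψ q` with smooth right-hand side; inversion of
operators is smooth. This yields smoothness of gradients. -/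
theorem smoothFieldAt_of_metric [FiniteDimensional ℝ E] (g : Metric E M)
    {Y : ∀ p : M, Tan E p} {p : M}
    (h : ∀ X : ∀ p : M, Tan E p, SmoothFieldAt X p →
      ContMDiffAt 𝓘(ℝ, E) 𝓘(ℝ, ℝ) ∞ (fun q => g.val q (Y q) (X q)) p) :
    SmoothFieldAt Y p := by
  have hc : CompleteSpace E := FiniteDimensional.complete ℝ E
  have hg := g.smooth p
  rw [contMDiffAt_hom_bundle] at hg
  set e := trivializationAt E (TangentSpace 𝓘(ℝ, E) : M → Type _) p with he
  set A : M → E →L[ℝ] E →L[ℝ] ℝ := fun q =>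
    (ContinuousLinearMap.inCoordinates E (TangentSpace 𝓘(ℝ, E) : M → Type _) (E →L[ℝ] ℝ)
    (fun p : M => TangentSpace 𝓘(ℝ, E) p →L[ℝ] ℝ) p q p q (g.val q)) with hA
  have hAs : ContMDiffAt 𝓘(ℝ, E) 𝓘(ℝ, E →L[ℝ] E →L[ℝ] ℝ) ∞ A p := hg.2
  have hAv : ∀ q ∈ e.baseSet, ∀ v w : E, A q v w = g.val q (e.symm q v) (e.symm q w) := by
    intro q hq v w
    simp only [hA]
    refine (inCoordinates_apply_eq₂ (F₃ := ℝ) (E₃ := Bundle.Trivial M ℝ) hq hq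
      (Set.mem_univ _)).trans ?_
    simp [he]
  have hpb : p ∈ e.baseSet := FiberBundle.mem_baseSet_trivializationAt' p
  have hnear : ∀ᶠ q in 𝓝 p, q ∈ e.baseSet := e.open_baseSet.mem_nhds hpb
  have hsymm : ∀ q ∈ e.baseSet, ∀ w : Tan E q, e.symm q (e ⟨q, w⟩).2 = w := by
    intro q hq w
    exact e.symm_apply_apply_mk hq w
  have hinv : ∀ q ∈ e.baseSet, (A q).IsInvertible := by
    intro q hq
    have hinj : Function.Injective (A q).toLinearMap := by
      rw [injective_iff_map_eq_zero]
      intro v hv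
      have h0 : e.symm q v = 0 := by
        refine g.nondegenerate q _ fun w => ?_
        rw [← hsymm q hq w, ← hAv q hq]
        exact DFunLike.congr_fun hv _
      have h1 := e.apply_mk_symm hq v
      rw [h0] at h1
      have h2 : (e ⟨q, 0⟩).2 = 0 := by
        have := (e.linearEquivAt ℝ q hq).map_zero
        simpa using this
      rw [h1] at h2
      exact h2
    have hdim : Module.finrank ℝ E = Module.finrank ℝ (E →L[ℝ] ℝ) := by
      rw [← LinearEquiv.finrank_eq (LinearMap.toContinuousLinearMap (𝕜 := ℝ) (E := E) (F' := ℝ))]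
      exact (Subspace.dual_finrank_eq).symm
    exact ⟨(LinearEquiv.ofInjectiveOfFinrankEq _ hinj hdim).toContinuousLinearEquiv, by ext; rfl⟩
  let b := Module.finBasis ℝ E
  let B : Fin (Module.finrank ℝ E) → ∀ q : M, Tan E q :=
    fun a => FiberBundle.extend E (e.symm p (b a))
  -- The extensions have constant coordinates in the trivialization, so pairing with them reads off
  -- the components of `A q` applied to the coordinates of `Y`.
  have hB : ∀ a, ∀ q ∈ e.baseSet, B a q = e.symm q (b a) := by
    intro a q hq
    have h1 := e.apply_mk_symm hpb (b a)
    simp only [B, FiberBundle.extend]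
    rw [← he, h1]
  let ψ : M → E →L[ℝ] ℝ := fun q =>
    ∑ a, (g.val q (Y q) (B a q)) • LinearMap.toContinuousLinearMap (b.coord a)
  have hψ : ContMDiffAt 𝓘(ℝ, E) 𝓘(ℝ, E →L[ℝ] ℝ) ∞ ψ p := by
    refine contMDiffAt_finsetSum fun a _ => ?_
    exact (h _ (FiberBundle.contMDiffAt_extend ..)).smul contMDiffAt_const
  have hsol : ∀ q ∈ e.baseSet, A q (e ⟨q, Y q⟩).2 = ψ q := by
    intro q hq
    have : (A q (e ⟨q, Y q⟩).2).toLinearMap = (ψ q).toLinearMap := by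
      refine b.ext fun a => ?_
      simp [ψ, hAv q hq, hsymm q hq, hB _ q hq, Finsupp.single_apply]
    exact ContinuousLinearMap.coe_injective this
  rw [SmoothFieldAt, contMDiffAt_totalSpace]
  refine ⟨contMDiffAt_id, ?_⟩
  have hAi : ContMDiffAt 𝓘(ℝ, E) 𝓘(ℝ, (E →L[ℝ] ℝ) →L[ℝ] E) ∞
      (fun q => ContinuousLinearMap.inverse (A q)) p :=
    ContDiffAt.comp_contMDiffAt (hinv p hpb).contDiffAt_map_inverse hAs
  refine (hAi.clm_apply hψ).congr_of_eventuallyEq ?_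
  filter_upwards [hnear] with q hq
  rw [← hsol q hq, (hinv q hq).inverse_apply_self]

/-- The endomorphism field of a smooth tensor maps smooth fields to smooth fields. -/
theorem smoothFieldAt_endo [FiniteDimensional ℝ E] (g : Metric E M) (T : SymTensor E M)
    {X : ∀ p : M, Tan E p} {p : M} (hX : SmoothFieldAt X p) :
    SmoothFieldAt (fun q => T.endo g q (X q)) p := by
  have h1 := ContMDiffAt.clm_bundle_apply (g.smooth p) hX
  exact ContMDiffAt.clm_bundle_apply (T.smooth p) h1

theorem diffFieldAt_endo [FiniteDimensional ℝ E] (g : Metric E M) (T : SymTensor E M)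
    {X : ∀ p : M, Tan E p} {p : M} (hX : DiffFieldAt X p) :
    DiffFieldAt (fun q => T.endo g q (X q)) p := by
  have h1 := MDifferentiableAt.clm_bundle_apply (g.smooth.mdifferentiable (by simp) p) hX
  exact MDifferentiableAt.clm_bundle_apply (T.smooth.mdifferentiable (by simp) p) h1

theorem val_grad [FiniteDimensional ℝ E] (g : Metric E M) (f : M → ℝ) (p : M) (v : Tan E p) :
    g.val p (g.grad f p) v = diff E f p v :=
  g.val_sharp p _ v

theorem smoothField_grad [FiniteDimensional ℝ E] (g : Metric E M) {f : M → ℝ}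
    (hf : SmoothFun E f) : SmoothField (g.grad f) := by
  intro p
  refine smoothFieldAt_of_metric g fun X hX => ?_
  simp only [val_grad]
  exact contMDiffAt_mvfderiv_apply (hf p) hX

/-- Every covector is the differential of a globally smooth function. -/
theorem exists_smoothFun_diff_eq [FiniteDimensional ℝ E] [T2Space M] (p : M) (α : Cotan E p) :
    ∃ f : M → ℝ, SmoothFun E f ∧ diff E f p = α := by
  obtain ⟨χ⟩ : Nonempty (SmoothBumpFunction 𝓘(ℝ, E) p) := inferInstance
  let α' : E →L[ℝ] ℝ := α
  -- A bump function makes the chart expression of the covector global; this is needed because the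
  -- Schouten condition is tested only on globally smooth functions.
  refine ⟨fun q => χ q • α' (extChartAt 𝓘(ℝ, E) p q), ?_, ?_⟩
  · refine χ.contMDiff_smul ?_
    exact α'.contMDiff.comp_contMDiffOn (contMDiffOn_extChartAt)
  · have h1 : (fun q => χ q • α' (extChartAt 𝓘(ℝ, E) p q)) =ᶠ[𝓝 p]
        α' ∘ extChartAt 𝓘(ℝ, E) p := by
      filter_upwards [χ.eventuallyEq_one] with q hq
      simp [hq]
    rw [diff, mvfderiv_congr h1]
    ext v
    have h2 : MDifferentiableAt 𝓘(ℝ, E) 𝓘(ℝ, E) (extChartAt 𝓘(ℝ, E) p) p :=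
      mdifferentiableAt_extChartAt (mem_chart_source E p)
    have h3 : MDifferentiableAt 𝓘(ℝ, E) 𝓘(ℝ, ℝ) α' (extChartAt 𝓘(ℝ, E) p p) :=
      α'.contMDiff.contMDiffAt.mdifferentiableAt one_ne_zero
    rw [mvfderiv_comp_apply p h3 h2, mfderiv_extChartAt_self, mvfderiv, mfderiv_eq_fderiv,
      α'.fderiv]
    rfl

/-- Every tangent vector is the value of a gradient. -/
theorem exists_grad_eq [FiniteDimensional ℝ E] [T2Space M] (g : Metric E M) (p : M)
    (v : Tan E p) : ∃ f : M → ℝ, SmoothFun E f ∧ g.grad f p = v := by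
  obtain ⟨f, hf, hfv⟩ := exists_smoothFun_diff_eq p (g.val p v)
  refine ⟨f, hf, g.flat_injective p ?_⟩
  ext w
  rw [val_grad, hfv]

theorem isLocallyConstant_of_diff_eq_zero {f : M → ℝ} (hf : SmoothFun E f)
    (h : ∀ p, diff E f p = 0) : IsLocallyConstant f := by
  rw [IsLocallyConstant.iff_eventually_eq]
  intro p
  set φ := extChartAt 𝓘(ℝ, E) p with hφ
  obtain ⟨r, hr, hball⟩ := Metric.mem_nhds_iff.1
    (extChartAt_target_mem_nhds (I := 𝓘(ℝ, E)) p)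
  have hz : ∀ y ∈ Metric.ball (φ p) r, HasFDerivAt (f ∘ φ.symm) (0 : E →L[ℝ] ℝ) y := by
    intro y hy
    have hd : DifferentiableAt ℝ (f ∘ φ.symm) y := by
      rw [← mdifferentiableAt_iff_differentiableAt]
      exact MDifferentiableAt.comp y (hf.mdifferentiable (by simp) _)
        (mdifferentiableAt_extChartAt_symm_self (hball hy))
    have h0 : fderiv ℝ (f ∘ φ.symm) y = 0 := by
      ext v
      rw [fderiv_comp_extChartAt_symm (hball hy) (hf.mdifferentiable (by simp) _)]
      exact DFunLike.congr_fun (h _) _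
    rw [← h0]
    exact hd.hasFDerivAt
  have hconst : ∀ y ∈ Metric.ball (φ p) r, (f ∘ φ.symm) y = (f ∘ φ.symm) (φ p) := by
    intro y hy
    refine (convex_ball (φ p) r).is_const_of_fderivWithin_eq_zero (𝕜 := ℝ)
      (fun z hz' => (hz z hz').differentiableAt.differentiableWithinAt) ?_ hy
      (Metric.mem_ball_self hr)
    intro z hz'
    rw [fderivWithin_of_isOpen Metric.isOpen_ball hz', (hz z hz').fderiv]
  have hc : ∀ᶠ q in 𝓝 p, φ q ∈ Metric.ball (φ p) r :=
    (continuousAt_extChartAt p).eventually (Metric.ball_mem_nhds _ hr)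
  filter_upwards [hc, extChartAt_source_mem_nhds (I := 𝓘(ℝ, E)) p] with q hq hqs
  have := hconst _ hq
  rwa [Function.comp_apply, Function.comp_apply, φ.left_inv hqs,
    φ.left_inv (mem_extChartAt_source p)] at this

end Smooth

/-! ### Calculus of the connection and the cyclic identity for `∇T` -/

section Nabla

variable [IsManifold 𝓘(ℝ, E) ∞ M] [FiniteDimensional ℝ E] {g : Metric E M}

theorem nabla_add_left {X X' Y : ∀ p : M, Tan E p} {p : M}
    (hX : DiffFieldAt X p) (hX' : DiffFieldAt X' p) (hY : DiffFieldAt Y p) :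
    nabla g (X + X') Y p = nabla g X Y p + nabla g X' Y p := by
  refine eq_of_forall_field (g := g) fun Z hZ => ?_
  have h := mdifferentiableAt_add_section hX hX'
  rw [map_add, add_apply, nabla_koszul hX hY hZ, nabla_koszul hX' hY hZ, nabla_koszul h hY hZ]
  have h1 := mdifferentiableAt_metric (g := g) hZ hX
  have h2 := mdifferentiableAt_metric (g := g) hZ hX'
  have h3 := mdifferentiableAt_metric (g := g) hX hY
  have h4 := mdifferentiableAt_metric (g := g) hX' hY
  simp only [koszul, diff, Pi.add_apply, map_add, add_apply]
  rw [VectorField.mlieBracket_add_right hX hX', VectorField.mlieBracket_add_left hX hX']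
  have e1 := mvfderiv_add h1 h2
  have e2 := mvfderiv_add h3 h4
  simp only [Pi.add_def] at e1 e2
  rw [e1, e2]
  simp only [map_add, add_apply]
  ring

theorem nabla_smul_left {f : M → ℝ} {X Y : ∀ p : M, Tan E p} {p : M}
    (hf : MDifferentiableAt 𝓘(ℝ, E) 𝓘(ℝ, ℝ) f p)
    (hX : DiffFieldAt X p) (hY : DiffFieldAt Y p) :
    nabla g (f • X) Y p = f p • nabla g X Y p := by
  refine eq_of_forall_field (g := g) fun Z hZ => ?_
  have h := hf.smul_section hX
  rw [map_smul, smul_apply, nabla_koszul hX hY hZ, nabla_koszul h hY hZ]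
  have h1 := mdifferentiableAt_metric (g := g) hZ hX
  have h3 := mdifferentiableAt_metric (g := g) hX hY
  simp only [koszul, diff, Pi.smul_apply', map_smul, smul_apply, smul_eq_mul]
  rw [VectorField.mlieBracket_smul_right hf hX, VectorField.mlieBracket_smul_left hf hX]
  have e1 := mvfderiv_mul hf h1
  have e2 := mvfderiv_mul hf h3
  simp only [Pi.mul_def] at e1 e2
  rw [e1, e2]
  simp only [map_add, map_smul, add_apply, smul_apply,
    smul_eq_mul, map_neg, neg_apply, neg_smul]
  rw [g.symm p (X p) (Z p)]
  ring

/-- Torsion-freeness reduces the rules in the second argument to those in the first and the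
corresponding rules for the bracket. -/
theorem nabla_add_right {X Y Y' : ∀ p : M, Tan E p} {p : M}
    (hX : DiffFieldAt X p) (hY : DiffFieldAt Y p) (hY' : DiffFieldAt Y' p) :
    nabla g X (Y + Y') p = nabla g X Y p + nabla g X Y' p := by
  have h := mdifferentiableAt_add_section hY hY'
  have e := nabla_torsion_free (g := g) hX h
  have e1 := nabla_torsion_free (g := g) hX hY
  have e2 := nabla_torsion_free (g := g) hX hY'
  rw [nabla_add_left hY hY' hX, VectorField.mlieBracket_add_right hY hY', ← e1, ← e2] at e
  rw [sub_eq_iff_eq_add] at e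
  rw [e]
  abel

theorem nabla_smul_right {f : M → ℝ} {X Y : ∀ p : M, Tan E p} {p : M}
    (hf : MDifferentiableAt 𝓘(ℝ, E) 𝓘(ℝ, ℝ) f p)
    (hX : DiffFieldAt X p) (hY : DiffFieldAt Y p) :
    nabla g X (f • Y) p = diff E f p (X p) • Y p + f p • nabla g X Y p := by
  have h := hf.smul_section hY
  have e := nabla_torsion_free (g := g) hX h
  have e1 := nabla_torsion_free (g := g) hX hY
  rw [nabla_smul_left hf hY hX, VectorField.mlieBracket_smul_right hf hY, ← e1] at e
  rw [sub_eq_iff_eq_add] at e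
  rw [e, smul_sub]
  abel

theorem val_endo_comm (T : SymTensor E M) (p : M) (v w : Tan E p) :
    g.val p (T.endo g p v) w = g.val p v (T.endo g p w) := by
  rw [g.symm p (T.endo g p v) w]
  exact T.symm p (g.val p v) (g.val p w)

/-- The covariant derivative `(∇_X T)(Y, Z)` of the symmetric tensor `T`. -/
noncomputable def covT (g : Metric E M) (T : SymTensor E M) (X Y Z : ∀ p : M, Tan E p)
    (p : M) : ℝ :=
  g.val p (nabla g X (fun q => T.endo g q (Y q)) p) (Z p)
    - g.val p (nabla g X Y p) (T.endo g p (Z p))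

/-- The derivatives of the scaling function produced by the two terms of `covT` cancel because `T`
is self-adjoint, so the expression is tensorial in `Y` as well as in `X`. Arbitrary arguments may
therefore be replaced by gradients with the same values. -/
theorem covT_congr (T : SymTensor E M) {X Y Z X' Y' Z' : ∀ p : M, Tan E p} {p : M}
    (hX : DiffFieldAt X p) (hY : DiffFieldAt Y p)
    (hX' : DiffFieldAt X' p) (hY' : DiffFieldAt Y' p)
    (eX : X p = X' p) (eY : Y p = Y' p) (eZ : Z p = Z' p) :
    covT g T X Y Z p = covT g T X' Y' Z' p := by
  have tX : TensorialAt 𝓘(ℝ, E) E (fun X => covT g T X Y Z p) p := by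
    refine ⟨fun {f W} hf hW => ?_, fun {W W'} hW hW' => ?_⟩
    · simp only [covT, nabla_smul_left hf hW hY, nabla_smul_left hf hW (diffFieldAt_endo g T hY),
        map_smul, smul_apply, smul_eq_mul]
      ring
    · simp only [covT, nabla_add_left hW hW' hY, nabla_add_left hW hW' (diffFieldAt_endo g T hY),
        map_add, add_apply]
      ring
  have tY : TensorialAt 𝓘(ℝ, E) E (fun Y => covT g T X' Y Z p) p := by
    refine ⟨fun {f W} hf hW => ?_, fun {W W'} hW hW' => ?_⟩
    · have hs : (fun q => T.endo g q ((f • W) q)) = f • (fun q => T.endo g q (W q)) := by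
        ext q; simp
      simp only [covT, hs, nabla_smul_right hf hX' hW,
        nabla_smul_right hf hX' (diffFieldAt_endo g T hW),
        map_smul, smul_apply, smul_eq_mul, map_add, add_apply, val_endo_comm]
      ring
    · have hs : (fun q => T.endo g q ((W + W') q)) =
          (fun q => T.endo g q (W q)) + (fun q => T.endo g q (W' q)) := by
        ext q; simp
      simp only [covT, hs, nabla_add_right hX' hW hW',
        nabla_add_right hX' (diffFieldAt_endo g T hW) (diffFieldAt_endo g T hW'),
        map_add, add_apply]
      ring
  have e1 : covT g T X Y Z p = covT g T X' Y Z p := tX.pointwise hX hX' eX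
  have e2 : covT g T X' Y Z p = covT g T X' Y' Z p := tY.pointwise hY hY' eY
  rw [e1, e2, covT, covT, eZ]

/-- The Hessian of a function is symmetric. -/
theorem hessian_symm {f : M → ℝ} (hf : SmoothFun E f) {X Y : ∀ p : M, Tan E p} {p : M}
    (hX : SmoothFieldAt X p) (hY : SmoothFieldAt Y p) :
    g.val p (nabla g X (g.grad f) p) (Y p) = g.val p (nabla g Y (g.grad f) p) (X p) := by
  have hc : CompleteSpace E := FiniteDimensional.complete ℝ E
  have hG := (smoothField_grad g hf).diff p
  have hX' := hX.diff
  have hY' := hY.diff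
  have e1 := nabla_metric (g := g) hX' hG hY'
  have e2 := nabla_metric (g := g) hY' hG hX'
  simp only [val_grad] at e1 e2
  -- The antisymmetric part of the Hessian is `XYf - YXf` minus `df` of `∇_X Y - ∇_Y X = [X, Y]`,
  -- hence zero.
  have e3 := mvfderiv_mlieBracket (hf p)
    ((contMDiffAt_mvfderiv_apply (hf p) hX).mdifferentiableAt (by simp))
    ((contMDiffAt_mvfderiv_apply (hf p) hY).mdifferentiableAt (by simp)) hX' hY'
  rw [← nabla_torsion_free (g := g) hX' hY', map_sub] at e3
  simp only [diff] at e1 e2 e3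
  linarith

variable {T : SymTensor E M} {t : ∀ p : M, Tan E p}

/-- By metric compatibility and symmetry of the Hessian, each term of the Schouten bracket is `-2
(∇T)` plus four Hessian terms; the latter cancel in pairs in the cyclic sum. This is why the test is
made on gradients. -/
theorem covT_cyclic_grad (hT : IsConformalKilling g T t) {f₁ f₂ f₃ : M → ℝ} (h₁ : SmoothFun E f₁)
    (h₂ : SmoothFun E f₂) (h₃ : SmoothFun E f₃) (p : M) :
    covT g T (g.grad f₁) (g.grad f₂) (g.grad f₃) p +
      covT g T (g.grad f₂) (g.grad f₃) (g.grad f₁) p +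
      covT g T (g.grad f₃) (g.grad f₁) (g.grad f₂) p =
    g.val p (t p) (g.grad f₁ p) * g.val p (g.grad f₂ p) (g.grad f₃ p) +
      g.val p (t p) (g.grad f₂ p) * g.val p (g.grad f₃ p) (g.grad f₁ p) +
      g.val p (t p) (g.grad f₃ p) * g.val p (g.grad f₁ p) (g.grad f₂ p) := by
  have key : ∀ {a b c : M → ℝ}, SmoothFun E a → SmoothFun E b → SmoothFun E c →
      2 * diff E (fun q => diff E c q (g.sharp q (diff E b q))) p (T.val p (diff E a p))
        - 2 * diff E (fun q => diff E c q (T.val q (diff E b q))) p (g.sharp p (diff E a p)) =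
      -2 * covT g T (g.grad a) (g.grad b) (g.grad c) p +
      2 * (g.val p (nabla g (fun q => T.endo g q (g.grad a q)) (g.grad b) p) (g.grad c p)
        + g.val p (nabla g (fun q => T.endo g q (g.grad a q)) (g.grad c) p) (g.grad b p)
        - g.val p (nabla g (fun q => T.endo g q (g.grad c q)) (g.grad b) p) (g.grad a p)
        - g.val p (nabla g (fun q => T.endo g q (g.grad b q)) (g.grad c) p) (g.grad a p)) := by
    intro a b c ha hb hc
    have sa := smoothField_grad g ha
    have sb := smoothField_grad g hb
    have sc := smoothField_grad g hc
    have hflat : ∀ (f : M → ℝ) q, T.val q (diff E f q) = T.endo g q (g.grad f q) := by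
      intro f q
      have : g.val q (g.grad f q) = diff E f q := by ext v; exact val_grad g f q v
      rw [← this]; rfl
    have r1 : (fun q => diff E c q (g.sharp q (diff E b q))) =
        fun q => g.val q (g.grad b q) (g.grad c q) := by
      ext q; rw [g.symm, val_grad]; rfl
    have r2 : (fun q => diff E c q (T.val q (diff E b q))) =
        fun q => g.val q (T.endo g q (g.grad b q)) (g.grad c q) := by
      ext q; rw [g.symm, val_grad, hflat]
    have m1 := nabla_metric (g := g) (smoothFieldAt_endo g T (sa p)).diff (sb.diff p) (sc.diff p)
    have m2 := nabla_metric (g := g) (sa.diff p) (smoothFieldAt_endo g T (sb p)).diff (sc.diff p)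
    have s1 := hessian_symm (g := g) hb (sa p) (smoothFieldAt_endo g T (sc p))
    have s2 := hessian_symm (g := g) hc (sa p) (smoothFieldAt_endo g T (sb p))
    rw [r1, r2, hflat]
    change 2 * _ - 2 * diff E _ p (g.grad a p) = _
    rw [m1, m2, covT, s1]
    rw [g.symm p (T.endo g p (g.grad b p)), s2, g.symm p (g.grad b p)]
    ring
  have hs := hT.schouten_eq f₁ f₂ f₃ h₁ h₂ h₃ p
  have k1 := key h₁ h₂ h₃
  have k2 := key h₂ h₃ h₁
  have k3 := key h₃ h₁ h₂
  simp only [schouten, symProd] at hs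
  rw [k1, k2, k3] at hs
  have hd : ∀ (f : M → ℝ), diff E f p (t p) = g.val p (t p) (g.grad f p) := by
    intro f; rw [g.symm, val_grad]
  have hd' : ∀ (f f' : M → ℝ), diff E f p (g.sharp p (diff E f' p)) =
      g.val p (g.grad f p) (g.grad f' p) := by
    intro f f'; rw [val_grad]; rfl
  simp only [hd, hd'] at hs
  rw [g.symm p (g.grad f₃ p) (g.grad f₂ p), g.symm p (g.grad f₂ p) (g.grad f₁ p),
    g.symm p (g.grad f₁ p) (g.grad f₃ p)] at hs
  linarith

theorem covT_cyclic [T2Space M] (hT : IsConformalKilling g T t) {X Y Z : ∀ p : M, Tan E p} {p : M}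
    (hX : DiffFieldAt X p) (hY : DiffFieldAt Y p) (hZ : DiffFieldAt Z p) :
    covT g T X Y Z p + covT g T Y Z X p + covT g T Z X Y p =
      g.val p (t p) (X p) * g.val p (Y p) (Z p) + g.val p (t p) (Y p) * g.val p (Z p) (X p) +
        g.val p (t p) (Z p) * g.val p (X p) (Y p) := by
  obtain ⟨f₁, h₁, e₁⟩ := exists_grad_eq g p (X p)
  obtain ⟨f₂, h₂, e₂⟩ := exists_grad_eq g p (Y p)
  obtain ⟨f₃, h₃, e₃⟩ := exists_grad_eq g p (Z p)
  have s₁ := (smoothField_grad g h₁).diff p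
  have s₂ := (smoothField_grad g h₂).diff p
  have s₃ := (smoothField_grad g h₃).diff p
  have h := covT_cyclic_grad hT h₁ h₂ h₃ p
  rw [covT_congr T s₁ s₂ hX hY e₁ e₂ e₃, covT_congr T s₂ s₃ hY hZ e₂ e₃ e₁,
    covT_congr T s₃ s₁ hZ hX e₃ e₁ e₂, e₁, e₂, e₃] at h
  exact h

theorem mem_eigenDist {μ : M → ℝ} {p : M} {v : Tan E p} :
    v ∈ eigenDist g T μ p ↔ T.endo g p v = μ p • v :=
  Module.End.mem_eigenspace_iff

theorem covT_of_sections {μ ν : M → ℝ} (hμ : SmoothFun E μ) {X Y Z : ∀ p : M, Tan E p} {p : M}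
    (hX : DiffFieldAt X p) (hY : DiffFieldAt Y p)
    (sY : ∀ q, Y q ∈ eigenDist g T μ q) (sZ : Z p ∈ eigenDist g T ν p) :
    covT g T X Y Z p = diff E μ p (X p) * g.val p (Y p) (Z p) +
      (μ p - ν p) * g.val p (nabla g X Y p) (Z p) := by
  have h : (fun q => T.endo g q (Y q)) = μ • Y := by
    ext q; exact mem_eigenDist.1 (sY q)
  rw [covT, h, nabla_smul_right (hμ.mdifferentiable (by simp) p) hX hY, mem_eigenDist.1 sZ]
  simp only [map_add, map_smul, add_apply, smul_apply, smul_eq_mul]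
  ring

end Nabla

/-! ### Orthogonal projections onto nondegenerate distributions -/

section Projections

variable [IsManifold 𝓘(ℝ, E) ∞ M] {g : Metric E M} {D : Dist E M}

theorem mem_perp {p : M} {w : Tan E p} : w ∈ perp g D p ↔ ∀ v ∈ D p, g.val p v w = 0 :=
  LinearMap.BilinForm.mem_orthogonal_iff

theorem bilin_isRefl (g : Metric E M) (p : M) : (g.bilin p).IsRefl := by
  intro v w h
  exact (g.symm p w v).trans h

variable [FiniteDimensional ℝ E]

theorem perp_perp (p : M) : perp g (perp g D) p = D p := by
  refine LinearMap.BilinForm.orthogonal_orthogonal ⟨?_, ?_⟩ (bilin_isRefl g p) (D p)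
  · exact g.nondegenerate p
  · intro w hw
    exact g.nondegenerate p w fun v => (g.symm p w v).trans (hw v)

/-- This excludes the default value `0` in `proj`, so that `proj` is the genuine orthogonal
projection. -/
theorem isCompl_perp (hD : IsNondegenerate g D) (p : M) : IsCompl (D p) (perp g D p) := by
  refine (LinearMap.BilinForm.isCompl_orthogonal_iff_disjoint (bilin_isRefl g p)).2 ?_
  rw [Submodule.disjoint_def]
  intro v hv hv'
  exact hD p v hv fun w hw => (g.symm p v w).trans (mem_perp.1 hv' w hw)

theorem isNondegenerate_perp (hD : IsNondegenerate g D) : IsNondegenerate g (perp g D) := by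
  intro p v hv h
  have h1 : v ∈ perp g (perp g D) p := mem_perp.2 fun w hw => (g.symm p w v).trans (h w hw)
  rw [perp_perp] at h1
  exact Submodule.disjoint_def.1 (isCompl_perp hD p).disjoint v h1 hv

theorem proj_mem (hD : IsNondegenerate g D) (p : M) (v : Tan E p) : proj g D p v ∈ D p := by
  rw [proj, dif_pos (isCompl_perp hD p)]
  exact Submodule.projection_apply_mem _ v

theorem val_proj (hD : IsNondegenerate g D) {p : M} (v : Tan E p) {w : Tan E p} (hw : w ∈ D p) :
    g.val p (proj g D p v) w = g.val p v w := by
  have h : v - proj g D p v ∈ perp g D p := by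
    rw [proj, dif_pos (isCompl_perp hD p)]
    exact Submodule.sub_projection_mem _ v
  have := mem_perp.1 h w hw
  rw [map_sub, g.symm p w v, g.symm p w (proj g D p v)] at this
  linarith

theorem proj_eq_iff (hD : IsNondegenerate g D) {p : M} {v w : Tan E p} (hw : w ∈ D p) :
    proj g D p v = w ↔ ∀ z ∈ D p, g.val p v z = g.val p w z := by
  constructor
  · rintro rfl z hz
    rw [val_proj hD v hz]
  · intro h
    rw [← sub_eq_zero]
    refine hD p _ (Submodule.sub_mem _ (proj_mem hD p v) hw) fun z hz => ?_
    rw [map_sub, sub_apply, val_proj hD v hz, h z hz, sub_self]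

theorem proj_eq_proj_iff (hD : IsNondegenerate g D) {p : M} {v w : Tan E p} :
    proj g D p v = proj g D p w ↔ ∀ z ∈ D p, g.val p v z = g.val p w z := by
  rw [proj_eq_iff hD (proj_mem hD p w)]
  exact forall₂_congr fun z hz => by rw [val_proj hD w hz]

theorem proj_eq_zero_iff (hD : IsNondegenerate g D) {p : M} {v : Tan E p} :
    proj g D p v = 0 ↔ ∀ z ∈ D p, g.val p v z = 0 := by
  rw [proj_eq_iff hD (Submodule.zero_mem _)]
  exact forall₂_congr fun z _ => by simp

end Projections

/-! ### Eigenspace components and their smoothness -/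

section Eigen

variable [IsManifold 𝓘(ℝ, E) ∞ M] [FiniteDimensional ℝ E] {g : Metric E M} {T : SymTensor E M}
  {ι : Type*} [Fintype ι] {lam : ι → M → ℝ}

theorem isNondegenerate_eigenDist
    (hI : IsOrthogonallyIntegrable g (fun i => eigenDist g T (lam i))) (i : ι) :
    IsNondegenerate g (eigenDist g T (lam i)) := hI.nondegenerate i

theorem eq_of_forall_eigenDist
    (hI : IsOrthogonallyIntegrable g (fun i => eigenDist g T (lam i))) {p : M} {v w : Tan E p}
    (h : ∀ i, ∀ z ∈ eigenDist g T (lam i) p, g.val p v z = g.val p w z) : v = w := by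
  refine g.flat_injective p (ContinuousLinearMap.ext fun z => ?_)
  have hz : z ∈ ⨆ i, eigenDist g T (lam i) p := by rw [hI.span p]; trivial
  refine Submodule.iSup_induction _ (motive := fun z => g.val p v z = g.val p w z) hz h (by simp) ?_
  intro x y hx hy
  rw [map_add, map_add, hx, hy]

theorem sum_proj (hI : IsOrthogonallyIntegrable g (fun i => eigenDist g T (lam i)))
    (p : M) (v : Tan E p) : ∑ i, proj g (eigenDist g T (lam i)) p v = v := by
  classical
  refine eq_of_forall_eigenDist hI fun i z hz => ?_
  rw [map_sum, sum_apply, Finset.sum_eq_single i,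
    val_proj (isNondegenerate_eigenDist hI i) v hz]
  · intro j _ hj
    exact hI.orthogonal p j i hj _ (proj_mem (isNondegenerate_eigenDist hI j) p v) z hz
  · simp

theorem proj_endo (hI : IsOrthogonallyIntegrable g (fun i => eigenDist g T (lam i)))
    (i : ι) (p : M) (v : Tan E p) :
    proj g (eigenDist g T (lam i)) p (T.endo g p v) =
      lam i p • proj g (eigenDist g T (lam i)) p v := by
  have hD := isNondegenerate_eigenDist hI i
  rw [proj_eq_iff hD (Submodule.smul_mem _ _ (proj_mem hD p v))]
  intro z hz
  rw [val_endo_comm, mem_eigenDist.1 hz, map_smul, map_smul, smul_apply, val_proj hD v hz]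

theorem proj_of_mem {D : Dist E M} (hD : IsNondegenerate g D) {p : M} {v : Tan E p}
    (hv : v ∈ D p) : proj g D p v = v :=
  (proj_eq_iff hD hv).2 fun _ _ => rfl

theorem mem_perp_eigenDist_iff (hI : IsOrthogonallyIntegrable g (fun i => eigenDist g T (lam i)))
    (i : ι) {p : M} {v : Tan E p} :
    v ∈ perp g (eigenDist g T (lam i)) p ↔ proj g (eigenDist g T (lam i)) p v = 0 := by
  rw [proj_eq_zero_iff (isNondegenerate_eigenDist hI i), mem_perp]
  exact forall₂_congr fun z _ => by rw [g.symm]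

theorem eigenDist_le_perp (hI : IsOrthogonallyIntegrable g (fun i => eigenDist g T (lam i)))
    {i j : ι} (hij : j ≠ i) (p : M) :
    eigenDist g T (lam j) p ≤ perp g (eigenDist g T (lam i)) p := fun w hw =>
  mem_perp.2 fun v hv => hI.orthogonal p i j hij.symm v hv w hw

omit [Fintype ι] in
theorem smoothFun_inv_sub (hO : IsOrthogonalTensor g T lam) {i j : ι} (hij : i ≠ j) :
    SmoothFun E (fun p => (lam i p - lam j p)⁻¹) := by
  intro p
  have h : ContMDiffAt 𝓘(ℝ, E) 𝓘(ℝ, ℝ) ∞ (fun p => lam i p - lam j p) p :=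
    (hO.smooth i p).sub (hO.smooth j p)
  exact h.inv₀ (sub_ne_zero.2 (hO.distinct p i j hij))

/-- The component of a smooth field in an eigenspace distribution is smooth. -/
theorem smoothField_proj (hO : IsOrthogonalTensor g T lam)
    (hI : IsOrthogonallyIntegrable g (fun i => eigenDist g T (lam i))) (i : ι)
    {X : ∀ p : M, Tan E p} (hX : SmoothField X) :
    SmoothField (fun p => proj g (eigenDist g T (lam i)) p (X p)) := by
  classical
  -- Lagrange interpolation: the projection is the product over `k ≠ i` of `(T - λ_k)/(λ_i - λ_k)`,
  -- a smooth expression since the eigenfunctions are smooth and distinct. The induction applies one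
  -- factor at a time, keeping the `E_i` component and killing those indexed by `s`.
  have key : ∀ s : Finset ι, i ∉ s → ∃ Y : ∀ p : M, Tan E p, SmoothField Y ∧
      (∀ p, proj g (eigenDist g T (lam i)) p (Y p) = proj g (eigenDist g T (lam i)) p (X p)) ∧
      ∀ k ∈ s, ∀ p, proj g (eigenDist g T (lam k)) p (Y p) = 0 := by
    intro s
    induction s using Finset.induction_on with
    | empty => exact fun _ => ⟨X, hX, fun _ => rfl, by simp⟩
    | insert k s hk ih =>
      intro hi
      rw [Finset.mem_insert, not_or] at hi
      obtain ⟨Y, hY, hYi, hYs⟩ := ih hi.2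
      have hTY : SmoothField (fun p => T.endo g p (Y p)) := fun p => smoothFieldAt_endo g T (hY p)
      refine ⟨(fun p => (lam i p - lam k p)⁻¹) • ((fun p => T.endo g p (Y p)) - lam k • Y),
        (smoothFun_inv_sub hO hi.1).smul_section
          (ContMDiff.sub_section hTY ((hO.smooth k).smul_section hY)), ?_, ?_⟩
      · intro p
        have h0 : lam i p - lam k p ≠ 0 := sub_ne_zero.2 (hO.distinct p i k hi.1)
        simp only [Pi.smul_apply', Pi.sub_apply, map_smul, map_sub, proj_endo hI, hYi p]
        rw [← sub_smul, smul_smul, inv_mul_cancel₀ h0, one_smul]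
      · intro l hl p
        simp only [Pi.smul_apply', Pi.sub_apply, map_smul, map_sub, proj_endo hI]
        rcases Finset.mem_insert.1 hl with rfl | hl
        · simp
        · simp [hYs l hl p]
  obtain ⟨Y, hY, hYi, hYs⟩ := key (Finset.univ.erase i) (by simp)
  have : (fun p => proj g (eigenDist g T (lam i)) p (X p)) = Y := by
    ext p
    rw [← hYi p]
    conv_rhs => rw [← sum_proj hI p (Y p)]
    rw [Finset.sum_eq_single i (fun k _ hk => hYs k (by simp [hk]) p) (by simp)]
  rw [this]
  exact hY

theorem isSection_proj (hO : IsOrthogonalTensor g T lam)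
    (hI : IsOrthogonallyIntegrable g (fun i => eigenDist g T (lam i))) (i : ι)
    {X : ∀ p : M, Tan E p} (hX : SmoothField X) :
    IsSection (eigenDist g T (lam i)) (fun p => proj g (eigenDist g T (lam i)) p (X p)) :=
  ⟨smoothField_proj hO hI i hX, fun p => proj_mem (isNondegenerate_eigenDist hI i) p (X p)⟩

/-- A gradient with the prescribed value is projected to the eigenspace; pointwise identities can
thus be proved with global sections. -/
theorem exists_isSection [T2Space M] (hO : IsOrthogonalTensor g T lam)
    (hI : IsOrthogonallyIntegrable g (fun i => eigenDist g T (lam i))) (i : ι)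
    {p : M} {v : Tan E p} (hv : v ∈ eigenDist g T (lam i) p) :
    ∃ X, IsSection (eigenDist g T (lam i)) X ∧ X p = v := by
  obtain ⟨f, hf, hfv⟩ := exists_grad_eq g p v
  refine ⟨_, isSection_proj hO hI i (smoothField_grad g hf), ?_⟩
  rw [hfv, proj_of_mem (isNondegenerate_eigenDist hI i) hv]

/-- Eigenspaces are nonzero and nondegenerate. The pair serves to cancel the factor `⟨X, Y⟩` in the
formula for the second fundamental form. -/
theorem exists_isSection_val_ne_zero [T2Space M] (hO : IsOrthogonalTensor g T lam)
    (hI : IsOrthogonallyIntegrable g (fun i => eigenDist g T (lam i))) (i : ι) (p : M) :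
    ∃ X Y, IsSection (eigenDist g T (lam i)) X ∧ IsSection (eigenDist g T (lam i)) Y ∧
      g.val p (X p) (Y p) ≠ 0 := by
  obtain ⟨v, hv, hv0⟩ := (hO.eigenvalue p i).exists_hasEigenvector
  have : ∃ w ∈ eigenDist g T (lam i) p, g.val p v w ≠ 0 := by
    by_contra! h
    exact hv0 (hI.nondegenerate i p v hv h)
  obtain ⟨w, hw, hvw⟩ := this
  obtain ⟨X, hX, rfl⟩ := exists_isSection hO hI i hv
  obtain ⟨Y, hY, rfl⟩ := exists_isSection hO hI i hw
  exact ⟨X, Y, hX, hY, hvw⟩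

omit [FiniteDimensional ℝ E] in
theorem IsSection.diffFieldAt {D : Dist E M} {X : ∀ p : M, Tan E p} (h : IsSection D X) (p : M) :
    DiffFieldAt X p :=
  SmoothField.diff h.1 p

end Eigen

/-! ### Second fundamental forms of the eigenspaces and of their complements -/

section Identities

variable [IsManifold 𝓘(ℝ, E) ∞ M] [FiniteDimensional ℝ E] {g : Metric E M} {T : SymTensor E M}
  {ι : Type*} [Fintype ι] {lam : ι → M → ℝ}

/-- Sections of `E_i` and `E_j` annihilate the `k`-th product coordinate, hence so does their
bracket. For `i = j` this is involutivity; for `i ≠ j` it places the bracket in `E_i ⊕ E_j`. -/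
theorem proj_mlieBracket_eq_zero
    (hI : IsOrthogonallyIntegrable g (fun i => eigenDist g T (lam i))) {i j k : ι}
    (hki : k ≠ i) (hkj : k ≠ j) {X Y : ∀ p : M, Tan E p}
    (hX : IsSection (eigenDist g T (lam i)) X) (hY : IsSection (eigenDist g T (lam j)) Y) (p : M) :
    proj g (eigenDist g T (lam k)) p (VectorField.mlieBracket 𝓘(ℝ, E) X Y p) = 0 := by
  classical
  have hc : CompleteSpace E := FiniteDimensional.complete ℝ E
  obtain ⟨d, φ, U, hp, -, -, hφ, -, hmem⟩ := hI.product p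
  have hsrc : ∀ᶠ q in 𝓝 p, q ∈ φ.source := φ.open_source.mem_nhds hp
  have hf : ContMDiffAt 𝓘(ℝ, E) 𝓘(ℝ, EuclideanSpace ℝ (Fin (d k))) ∞ (fun x => φ x k) p :=
    (ContinuousLinearMap.proj (R := ℝ) (φ := fun i => EuclideanSpace ℝ (Fin (d i)))
      k).contMDiff.contMDiffAt.comp p (hφ.contMDiffAt hsrc)
  have hzero : ∀ (l : ι), k ≠ l → ∀ (W : ∀ p : M, Tan E p),
      IsSection (eigenDist g T (lam l)) W →
      (fun q => mvfderiv 𝓘(ℝ, E) (fun x => φ x k) q (W q)) =ᶠ[𝓝 p] fun _ => 0 := by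
    intro l hl W hW
    filter_upwards [hsrc] with q hq
    exact (hmem q hq l (W q)).1 (hW.2 q) k hl
  set w := VectorField.mlieBracket 𝓘(ℝ, E) X Y p with hw
  have hdw : mvfderiv 𝓘(ℝ, E) (fun x => φ x k) p w = 0 := by
    rw [hw, mvfderiv_mlieBracket hf
      ((contMDiffAt_mvfderiv_apply hf (hX.1 p)).mdifferentiableAt (by simp))
      ((contMDiffAt_mvfderiv_apply hf (hY.1 p)).mdifferentiableAt (by simp))
      (hX.diffFieldAt p) (hY.diffFieldAt p), mvfderiv_congr (hzero i hki X hX),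
      mvfderiv_congr (hzero j hkj Y hY)]
    simp [mvfderiv_const]
  have hD := isNondegenerate_eigenDist hI k
  have hdk : mvfderiv 𝓘(ℝ, E) (fun x => φ x k) p (proj g (eigenDist g T (lam k)) p w) = 0 := by
    rw [← sum_proj hI p w, map_sum, Finset.sum_eq_single k] at hdw
    · exact hdw
    · intro l _ hl
      exact (hmem p hp l _).1 (proj_mem (isNondegenerate_eigenDist hI l) p w) k hl.symm
    · simp
  -- All product coordinates have zero derivative along the `E_k` component, so it also lies in
  -- `E_i`; being orthogonal to `E_k` it vanishes by nondegeneracy.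
  have hmi : proj g (eigenDist g T (lam k)) p w ∈ eigenDist g T (lam i) p := by
    refine (hmem p hp i _).2 fun l _ => ?_
    by_cases hl : l = k
    · subst hl; exact hdk
    · exact (hmem p hp k _).1 (proj_mem hD p w) l hl
  exact hD p _ (proj_mem hD p w) fun z hz => hI.orthogonal p i k hki.symm _ hmi z hz

theorem val_mlieBracket_eq_zero
    (hI : IsOrthogonallyIntegrable g (fun i => eigenDist g T (lam i))) {i j k : ι}
    (hki : k ≠ i) (hkj : k ≠ j) {X Y : ∀ p : M, Tan E p}
    (hX : IsSection (eigenDist g T (lam i)) X) (hY : IsSection (eigenDist g T (lam j)) Y) {p : M}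
    {z : Tan E p} (hz : z ∈ eigenDist g T (lam k) p) :
    g.val p (VectorField.mlieBracket 𝓘(ℝ, E) X Y p) z = 0 :=
  (proj_eq_zero_iff (isNondegenerate_eigenDist hI k)).1
    (proj_mlieBracket_eq_zero hI hki hkj hX hY p) z hz

omit [Fintype ι] [FiniteDimensional ℝ E] in
theorem diff_val_eq_zero {X Y : ∀ p : M, Tan E p} (h : ∀ q, g.val q (X q) (Y q) = 0) (p : M) :
    diff E (fun q => g.val q (X q) (Y q)) p = 0 := by
  have : (fun q => g.val q (X q) (Y q)) = fun _ => 0 := funext h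
  rw [this, diff, mvfderiv_const]

theorem val_nabla_of_orthogonal {X Y Z : ∀ p : M, Tan E p} {p : M}
    (hX : DiffFieldAt X p) (hY : DiffFieldAt Y p) (hZ : DiffFieldAt Z p)
    (h : ∀ q, g.val q (Y q) (Z q) = 0) :
    g.val p (nabla g X Y p) (Z p) = - g.val p (Y p) (nabla g X Z p) := by
  have := nabla_metric (g := g) hX hY hZ
  rw [diff_val_eq_zero h, zero_apply] at this
  linarith

variable [T2Space M] {t : ∀ p : M, Tan E p}

/-- Each eigenfunction of a conformal Killing tensor has the conformal factor as its gradient along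
its own eigenspaces. -/
theorem diff_eq_of_mem_eigenDist (hO : IsOrthogonalTensor g T lam)
    (hI : IsOrthogonallyIntegrable g (fun i => eigenDist g T (lam i)))
    (hT : IsConformalKilling g T t) (i : ι) {p : M} {v : Tan E p}
    (hv : v ∈ eigenDist g T (lam i) p) :
    diff E (lam i) p v = g.val p (t p) v := by
  have key : ∀ x ∈ eigenDist g T (lam i) p, ∀ y ∈ eigenDist g T (lam i) p,
      ∀ z ∈ eigenDist g T (lam i) p,
      (diff E (lam i) p x - g.val p (t p) x) * g.val p y z +
        (diff E (lam i) p y - g.val p (t p) y) * g.val p z x +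
        (diff E (lam i) p z - g.val p (t p) z) * g.val p x y = 0 := by
    intro x hx y hy z hz
    obtain ⟨X, hX, rfl⟩ := exists_isSection hO hI i hx
    obtain ⟨Y, hY, rfl⟩ := exists_isSection hO hI i hy
    obtain ⟨Z, hZ, rfl⟩ := exists_isSection hO hI i hz
    have h := covT_cyclic hT (hX.diffFieldAt p) (hY.diffFieldAt p) (hZ.diffFieldAt p)
    rw [covT_of_sections (hO.smooth i) (hX.diffFieldAt p) (hY.diffFieldAt p) hY.2 (hZ.2 p),
      covT_of_sections (hO.smooth i) (hY.diffFieldAt p) (hZ.diffFieldAt p) hZ.2 (hX.2 p),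
      covT_of_sections (hO.smooth i) (hZ.diffFieldAt p) (hX.diffFieldAt p) hX.2 (hY.2 p)] at h
    linarith
  -- For non-null `v` the identity at `(v, v, v)` suffices. A null `v ≠ 0` needs a partner `w` with
  -- `⟨v, w⟩ ≠ 0`, and the identity at `(v, v, w)`.
  by_cases hvv : g.val p v v = 0
  · by_cases hv0 : v = 0
    · simp [hv0]
    have : ∃ w ∈ eigenDist g T (lam i) p, g.val p v w ≠ 0 := by
      by_contra! h
      exact hv0 (hI.nondegenerate i p v hv h)
    obtain ⟨w, hw, hvw⟩ := this
    have h := key v hv v hv w hw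
    rw [hvv, g.symm p w v] at h
    have h2 : (diff E (lam i) p v - g.val p (t p) v) * g.val p v w = 0 := by linarith
    exact sub_eq_zero.1 ((mul_eq_zero.1 h2).resolve_right hvw)
  · have h := key v hv v hv v hv
    have h2 : (diff E (lam i) p v - g.val p (t p) v) * g.val p v v = 0 := by linarith
    exact sub_eq_zero.1 ((mul_eq_zero.1 h2).resolve_right hvv)

/-- The second fundamental form of an eigenspace distribution of a conformal Killing tensor. -/
theorem val_nabla_of_conformalKilling (hO : IsOrthogonalTensor g T lam)
    (hI : IsOrthogonallyIntegrable g (fun i => eigenDist g T (lam i)))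
    (hT : IsConformalKilling g T t) {i j : ι} (hij : j ≠ i) {X Y : ∀ p : M, Tan E p}
    (hX : IsSection (eigenDist g T (lam i)) X) (hY : IsSection (eigenDist g T (lam i)) Y) {p : M}
    {z : Tan E p} (hz : z ∈ eigenDist g T (lam j) p) :
    2 * (lam i p - lam j p) * g.val p (nabla g X Y p) z =
      (g.val p (t p) z - diff E (lam i) p z) * g.val p (X p) (Y p) := by
  obtain ⟨Z, hZ, rfl⟩ := exists_isSection hO hI j hz
  have dX := hX.diffFieldAt p
  have dY := hY.diffFieldAt p
  have dZ := hZ.diffFieldAt p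
  have h := covT_cyclic hT dX dY dZ
  have oYZ : g.val p (Y p) (Z p) = 0 := hI.orthogonal p i j hij.symm _ (hY.2 p) _ (hZ.2 p)
  have oZX : ∀ q, g.val q (Z q) (X q) = 0 := fun q =>
    hI.orthogonal q j i hij _ (hZ.2 q) _ (hX.2 q)
  have hs := val_nabla_of_orthogonal (g := g) dY dZ dX oZX
  -- Involutivity of `E_i` identifies `⟨∇_Y X, Z⟩` with `⟨∇_X Y, Z⟩`, so two of the three cyclic
  -- terms coincide; this is the factor `2`.
  have hb := val_mlieBracket_eq_zero hI hij hij hX hY (hZ.2 p)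
  rw [← nabla_torsion_free (g := g) dX dY, map_sub, sub_apply] at hb
  rw [covT_of_sections (hO.smooth i) dX dY hY.2 (hZ.2 p),
    covT_of_sections (hO.smooth j) dY dZ hZ.2 (hX.2 p),
    covT_of_sections (hO.smooth i) dZ dX hX.2 (hY.2 p), oYZ, oZX p, hs,
    g.symm p (Z p) (nabla g Y X p)] at h
  have hb' : g.val p (nabla g Y X p) (Z p) = g.val p (nabla g X Y p) (Z p) := by linarith
  rw [hb'] at h
  linarith

omit [T2Space M] in
theorem forall_perp_val_eq
    (hI : IsOrthogonallyIntegrable g (fun i => eigenDist g T (lam i))) {i : ι} {p : M}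
    {v w : Tan E p} (h : ∀ j, j ≠ i → ∀ z ∈ eigenDist g T (lam j) p, g.val p v z = g.val p w z)
    {z : Tan E p} (hz : z ∈ perp g (eigenDist g T (lam i)) p) : g.val p v z = g.val p w z := by
  rw [← sum_proj hI p z, map_sum, map_sum]
  refine Finset.sum_congr rfl fun j _ => ?_
  by_cases hj : j = i
  · subst hj
    rw [(mem_perp_eigenDist_iff hI j).1 hz, map_zero, map_zero]
  · exact h j hj _ (proj_mem (isNondegenerate_eigenDist hI j) p z)

theorem isGeodesic_eigenDist_iff (hO : IsOrthogonalTensor g T lam)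
    (hI : IsOrthogonallyIntegrable g (fun i => eigenDist g T (lam i)))
    (hT : IsConformalKilling g T t) (i : ι) :
    IsGeodesic g (eigenDist g T (lam i)) ↔
      ∀ j, j ≠ i → ∀ p, ∀ z ∈ eigenDist g T (lam j) p, diff E (lam i) p z = g.val p (t p) z := by
  have hD := isNondegenerate_eigenDist hI i
  constructor
  · intro h j hj p z hz
    obtain ⟨X, Y, hX, hY, hXY⟩ := exists_isSection_val_ne_zero hO hI i p
    have h1 := (proj_eq_zero_iff (isNondegenerate_perp hD)).1 (h.secondForm_eq X Y hX hY p) z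
      (eigenDist_le_perp hI hj p hz)
    have h2 := val_nabla_of_conformalKilling hO hI hT hj hX hY hz
    rw [h1, mul_zero] at h2
    have := (mul_eq_zero.1 h2.symm).resolve_right hXY
    linarith
  · refine fun h => ⟨hD, fun X Y hX hY p => ?_⟩
    refine (proj_eq_zero_iff (isNondegenerate_perp hD)).2 fun z hz => ?_
    rw [forall_perp_val_eq hI (w := 0) _ hz, map_zero, zero_apply]
    intro j hj z hz
    have h2 := val_nabla_of_conformalKilling hO hI hT hj hX hY hz
    rw [h j hj p z hz, sub_self, zero_mul] at h2
    have h3 : 2 * (lam i p - lam j p) ≠ 0 :=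
      mul_ne_zero two_ne_zero (sub_ne_zero.2 (hO.distinct p i j hj.symm))
    rw [(mul_eq_zero.1 h2).resolve_left h3, map_zero, zero_apply]

theorem diff_eq_of_isGeodesic_perp (hO : IsOrthogonalTensor g T lam)
    (hI : IsOrthogonallyIntegrable g (fun i => eigenDist g T (lam i)))
    (hT : IsConformalKilling g T t) {i : ι} (h : IsGeodesic g (perp g (eigenDist g T (lam i))))
    {j : ι} (hj : j ≠ i) {p : M} {z : Tan E p} (hz : z ∈ eigenDist g T (lam i) p) :
    diff E (lam j) p z = g.val p (t p) z := by
  have hD := isNondegenerate_eigenDist hI i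
  obtain ⟨X, Y, hX, hY, hXY⟩ := exists_isSection_val_ne_zero hO hI j p
  have hle := eigenDist_le_perp hI hj
  have h1 := (proj_eq_zero_iff (isNondegenerate_perp (isNondegenerate_perp hD))).1
    (h.secondForm_eq X Y ⟨hX.1, fun q => hle q (hX.2 q)⟩ ⟨hY.1, fun q => hle q (hY.2 q)⟩ p) z
    (by rw [perp_perp]; exact hz)
  have h2 := val_nabla_of_conformalKilling hO hI hT hj.symm hX hY hz
  rw [h1, mul_zero] at h2
  have := (mul_eq_zero.1 h2.symm).resolve_right hXY
  linarith

/-- If `j = k`, the formula for the second fundamental form of `E_j` applies. If `i, j, k` are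
distinct, every term of the Koszul formula vanishes, by orthogonality or by the product structure.
-/
theorem val_nabla_eq_zero_of_ne (hO : IsOrthogonalTensor g T lam)
    (hI : IsOrthogonallyIntegrable g (fun i => eigenDist g T (lam i)))
    (hT : IsConformalKilling g T t) {i : ι}
    (h : ∀ j, j ≠ i → ∀ p, ∀ z ∈ eigenDist g T (lam i) p, diff E (lam j) p z = g.val p (t p) z)
    {j k : ι} (hj : j ≠ i) (hk : k ≠ i) {X Y Z : ∀ p : M, Tan E p}
    (hX : IsSection (eigenDist g T (lam j)) X) (hY : IsSection (eigenDist g T (lam k)) Y)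
    (hZ : IsSection (eigenDist g T (lam i)) Z) (p : M) :
    g.val p (nabla g X Y p) (Z p) = 0 := by
  by_cases hjk : j = k
  · subst hjk
    have h2 := val_nabla_of_conformalKilling hO hI hT hj.symm hX hY (hZ.2 p)
    rw [h j hj p _ (hZ.2 p), sub_self, zero_mul] at h2
    exact (mul_eq_zero.1 h2).resolve_left
      (mul_ne_zero two_ne_zero (sub_ne_zero.2 (hO.distinct p j i hj)))
  · rw [nabla_koszul (hX.diffFieldAt p) (hY.diffFieldAt p) (hZ.diffFieldAt p), koszul,
      diff_val_eq_zero (fun q => hI.orthogonal q k i hk _ (hY.2 q) _ (hZ.2 q)),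
      diff_val_eq_zero (fun q => hI.orthogonal q i j hj.symm _ (hZ.2 q) _ (hX.2 q)),
      diff_val_eq_zero (fun q => hI.orthogonal q j k hjk _ (hX.2 q) _ (hY.2 q)),
      val_mlieBracket_eq_zero hI hj.symm hk.symm hX hY (hZ.2 p),
      val_mlieBracket_eq_zero hI hjk hj hY hZ (hX.2 p),
      val_mlieBracket_eq_zero hI hk (Ne.symm hjk) hZ hX (hY.2 p)]
    simp

omit [T2Space M] [Fintype ι] in
theorem tensorialAt_nabla {Y : ∀ p : M, Tan E p} {p : M} (hY : DiffFieldAt Y p) :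
    TensorialAt 𝓘(ℝ, E) E (fun X => nabla g X Y p) p where
  smul hf hX := nabla_smul_left hf hX hY
  add hX hX' := nabla_add_left hX hX' hY

theorem isGeodesic_perp_of_diff_eq (hO : IsOrthogonalTensor g T lam)
    (hI : IsOrthogonallyIntegrable g (fun i => eigenDist g T (lam i)))
    (hT : IsConformalKilling g T t) {i : ι}
    (h : ∀ j, j ≠ i → ∀ p, ∀ z ∈ eigenDist g T (lam i) p, diff E (lam j) p z = g.val p (t p) z) :
    IsGeodesic g (perp g (eigenDist g T (lam i))) := by
  have hD := isNondegenerate_eigenDist hI i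
  refine ⟨isNondegenerate_perp hD, fun X Y hX hY p => ?_⟩
  refine (proj_eq_zero_iff (isNondegenerate_perp (isNondegenerate_perp hD))).2 fun z hz => ?_
  rw [perp_perp] at hz
  obtain ⟨Z, hZ, rfl⟩ := exists_isSection hO hI i hz
  have dX := hX.diffFieldAt p
  have dZ := hZ.diffFieldAt p
  have oYZ : ∀ q, g.val q (Y q) (Z q) = 0 := fun q => by
    rw [g.symm]; exact mem_perp.1 (hY.2 q) _ (hZ.2 q)
  -- Moving the derivative onto `Z` makes the expression depend on `X` and `Y` only through their
  -- values, so both can be split into eigencomponents.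
  rw [val_nabla_of_orthogonal dX (hY.diffFieldAt p) dZ oYZ, neg_eq_zero]
  have sX : ∀ j, IsSection (eigenDist g T (lam j))
      (fun q => proj g (eigenDist g T (lam j)) q (X q)) := fun j => isSection_proj hO hI j hX.1
  have sY : ∀ j, IsSection (eigenDist g T (lam j))
      (fun q => proj g (eigenDist g T (lam j)) q (Y q)) := fun j => isSection_proj hO hI j hY.1
  have hsum : nabla g X Z p =
      ∑ j, nabla g (fun q => proj g (eigenDist g T (lam j)) q (X q)) Z p := by
    have := (tensorialAt_nabla (g := g) dZ).sum (s := Finset.univ)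
      (fun j q => proj g (eigenDist g T (lam j)) q (X q)) (fun j _ => (sX j).diffFieldAt p)
    rw [← this]
    congr 1
    ext q
    exact (sum_proj hI q (X q)).symm
  rw [hsum, map_sum]
  refine Finset.sum_eq_zero fun j _ => ?_
  by_cases hj : j = i
  · have h0 : (fun q => proj g (eigenDist g T (lam j)) q (X q)) = 0 := by
      ext q
      subst hj
      exact (mem_perp_eigenDist_iff hI j).1 (hX.2 q)
    rw [h0, (tensorialAt_nabla (g := g) dZ).zero, map_zero]
  · rw [← sum_proj hI p (Y p), map_sum, sum_apply]
    refine Finset.sum_eq_zero fun k _ => ?_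
    by_cases hk : k = i
    · subst hk
      rw [(mem_perp_eigenDist_iff hI k).1 (hY.2 p), map_zero, zero_apply]
    · have h1 := val_nabla_eq_zero_of_ne hO hI hT h hj hk (sX j) (sY k) hZ p
      rw [val_nabla_of_orthogonal ((sX j).diffFieldAt p) ((sY k).diffFieldAt p) dZ
        (fun q => hI.orthogonal q k i hk _ ((sY k).2 q) _ (hZ.2 q))] at h1
      exact neg_eq_zero.1 h1

end Identities

/-! ### Mean curvature normals, sphericity and the characterizations -/

section Spherical

variable [IsManifold 𝓘(ℝ, E) ∞ M] [FiniteDimensional ℝ E] {g : Metric E M} {T : SymTensor E M}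
  {ι : Type*} [Fintype ι] {lam : ι → M → ℝ} {t : ∀ p : M, Tan E p}

open Classical in
/-- The mean curvature normal of the eigenspace distribution of `lam i`. -/
noncomputable def meanNormal (g : Metric E M) (T : SymTensor E M) (lam : ι → M → ℝ)
    (t : ∀ p : M, Tan E p) (i : ι) (p : M) : Tan E p :=
  ∑ j ∈ Finset.univ.erase i, (1 / 2 * (lam i p - lam j p)⁻¹ : ℝ) •
    proj g (eigenDist g T (lam j)) p (t p - g.grad (lam i) p)

theorem smoothField_meanNormal (hO : IsOrthogonalTensor g T lam)
    (hI : IsOrthogonallyIntegrable g (fun i => eigenDist g T (lam i)))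
    (ht : SmoothField t) (i : ι) : SmoothField (meanNormal g T lam t i) := by
  classical
  refine ContMDiff.sum_section fun j hj => ?_
  have hd : SmoothField (t - g.grad (lam i)) :=
    ContMDiff.sub_section ht (smoothField_grad g (hO.smooth i))
  have hc : SmoothFun E (fun p => 1 / 2 * (lam i p - lam j p)⁻¹ : M → ℝ) :=
    ContMDiff.mul contMDiff_const (smoothFun_inv_sub hO (Finset.ne_of_mem_erase hj).symm)
  exact hc.smul_section (smoothField_proj hO hI j hd)

theorem val_meanNormal (hI : IsOrthogonallyIntegrable g (fun i => eigenDist g T (lam i)))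
    {i j : ι} (hj : j ≠ i) {p : M} {z : Tan E p} (hz : z ∈ eigenDist g T (lam j) p) :
    g.val p (meanNormal g T lam t i p) z =
      1 / 2 * (lam i p - lam j p)⁻¹ * (g.val p (t p) z - diff E (lam i) p z) := by
  classical
  rw [meanNormal, map_sum, sum_apply, Finset.sum_eq_single j]
  · rw [map_smul, smul_apply, val_proj (isNondegenerate_eigenDist hI j) _ hz, map_sub, sub_apply,
      val_grad, smul_eq_mul]
  · intro k _ hk
    rw [map_smul, smul_apply, hI.orthogonal p k j hk _
      (proj_mem (isNondegenerate_eigenDist hI k) p _) z hz, smul_zero]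
  · exact fun h => absurd (Finset.mem_erase.2 ⟨hj, Finset.mem_univ j⟩) h

theorem val_meanNormal_self (hI : IsOrthogonallyIntegrable g (fun i => eigenDist g T (lam i)))
    {i : ι} {p : M} {z : Tan E p} (hz : z ∈ eigenDist g T (lam i) p) :
    g.val p (meanNormal g T lam t i p) z = 0 := by
  classical
  rw [meanNormal, map_sum, sum_apply]
  refine Finset.sum_eq_zero fun j hj => ?_
  rw [map_smul, smul_apply, hI.orthogonal p j i (Finset.ne_of_mem_erase hj) _
    (proj_mem (isNondegenerate_eigenDist hI j) p _) z hz, smul_zero]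

theorem meanNormal_mem_perp (hI : IsOrthogonallyIntegrable g (fun i => eigenDist g T (lam i)))
    (i : ι) (p : M) : meanNormal g T lam t i p ∈ perp g (eigenDist g T (lam i)) p :=
  mem_perp.2 fun v hv => by rw [g.symm]; exact val_meanNormal_self hI hv

/-- The eigenspace distributions of a conformal Killing tensor are umbilical. -/
theorem isUmbilicalWith_meanNormal [T2Space M] (hO : IsOrthogonalTensor g T lam)
    (hI : IsOrthogonallyIntegrable g (fun i => eigenDist g T (lam i)))
    (hT : IsConformalKilling g T t) (i : ι) :
    IsUmbilicalWith g (eigenDist g T (lam i)) (meanNormal g T lam t i) := by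
  have hD := isNondegenerate_eigenDist hI i
  have hs : ∀ X Y, IsSection (eigenDist g T (lam i)) X → IsSection (eigenDist g T (lam i)) Y →
      ∀ p, secondForm g (eigenDist g T (lam i)) X Y p =
        g.val p (X p) (Y p) • meanNormal g T lam t i p := by
    intro X Y hX hY p
    refine (proj_eq_iff (isNondegenerate_perp hD)
      (Submodule.smul_mem _ _ (meanNormal_mem_perp hI i p))).2 fun z hz => ?_
    refine forall_perp_val_eq hI (fun j hj z hz => ?_) hz
    have h0 : lam i p - lam j p ≠ 0 := sub_ne_zero.2 (hO.distinct p i j hj.symm)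
    have h2 := val_nabla_of_conformalKilling hO hI hT hj hX hY hz
    rw [map_smul, smul_apply, smul_eq_mul, val_meanNormal hI hj hz]
    field_simp
    linarith
  refine ⟨hD, ⟨⟨smoothField_meanNormal hO hI hT.smooth i, meanNormal_mem_perp hI i⟩, ?_⟩, hs⟩
  intro p X hX _ hne
  -- By umbilicity each normalized diagonal term equals `H`, so the trace is the rank times `H`.
  have : ∀ a, (g.val p (X a p) (X a p))⁻¹ • symSecondForm g (eigenDist g T (lam i)) (X a) (X a) p =
      meanNormal g T lam t i p := by
    intro a
    rw [symSecondForm, hs _ _ (hX a) (hX a), ← two_smul ℝ, smul_smul, smul_smul, smul_smul]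
    have h1 := hne a
    rw [show (g.val p (X a p) (X a p))⁻¹ * (1 / 2) * 2 * g.val p (X a p) (X a p) = 1 by
      field_simp, one_smul]
  rw [Finset.sum_congr rfl fun a _ => this a, Finset.sum_const, Finset.card_univ, Fintype.card_fin,
    Nat.cast_smul_eq_nsmul]

/-- Umbilicity is automatic, and the forward direction uses only that `E_i^⊥` is geodesic. The work
lies in showing that the condition on the eigenfunctions also makes `H` parallel in the normal
directions along `E_i`. -/
theorem isKilling_eigenDist_iff [T2Space M] (hO : IsOrthogonalTensor g T lam)
    (hI : IsOrthogonallyIntegrable g (fun i => eigenDist g T (lam i)))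
    (hT : IsConformalKilling g T t) (i : ι) :
    IsKilling g (eigenDist g T (lam i)) ↔
      ∀ j, j ≠ i → ∀ p, ∀ z ∈ eigenDist g T (lam i) p, diff E (lam j) p z = g.val p (t p) z := by
  have hc : CompleteSpace E := FiniteDimensional.complete ℝ E
  refine ⟨fun h j hj p z hz => diff_eq_of_isGeodesic_perp hO hI hT h.2 hj hz, fun h => ?_⟩
  have hD := isNondegenerate_eigenDist hI i
  have hgeo := isGeodesic_perp_of_diff_eq hO hI hT h
  refine ⟨⟨meanNormal g T lam t i, isUmbilicalWith_meanNormal hO hI hT i, fun X hX p => ?_⟩, hgeo⟩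
  set H := meanNormal g T lam t i with hH
  have sH : IsSection (perp g (eigenDist g T (lam i))) H :=
    ⟨smoothField_meanNormal hO hI hT.smooth i, meanNormal_mem_perp hI i⟩
  refine (proj_eq_zero_iff (isNondegenerate_perp hD)).2 fun z hz => ?_
  rw [forall_perp_val_eq hI (w := 0) _ hz, map_zero, zero_apply]
  intro j hj z hz
  rw [map_zero, zero_apply]
  obtain ⟨Z, hZ, rfl⟩ := exists_isSection hO hI j hz
  have dX := hX.diffFieldAt p
  have dZ := hZ.diffFieldAt p
  have dH := sH.diffFieldAt p
  have h0 : lam i p - lam j p ≠ 0 := sub_ne_zero.2 (hO.distinct p i j hj.symm)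
  let f : M → ℝ := fun q => lam i q - lam j q
  have hf : SmoothFun E f := fun q => (hO.smooth i q).sub (hO.smooth j q)
  have hdf : ∀ q (v : Tan E q), diff E f q v = diff E (lam i) q v - diff E (lam j) q v := by
    intro q v
    have := mvfderiv_sub ((hO.smooth i).mdifferentiable (by simp) q)
      ((hO.smooth j).mdifferentiable (by simp) q)
    exact DFunLike.congr_fun this v
  have hdfi : ∀ q, ∀ v ∈ eigenDist g T (lam i) q, diff E f q v = 0 := by
    intro q v hv
    rw [hdf, h j hj q v hv, diff_eq_of_mem_eigenDist hO hI hT i hv, sub_self]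
  -- On `E_j` the factor `t` can be replaced by the gradient of `λ_j`, which turns the numerator of
  -- `H` into `-df`.
  have hfH : ∀ q, ∀ v ∈ eigenDist g T (lam j) q, f q * g.val q (H q) v =
      -(1 / 2) * diff E f q v := by
    intro q v hv
    have hq : lam i q - lam j q ≠ 0 := sub_ne_zero.2 (hO.distinct q i j hj.symm)
    rw [hH, val_meanNormal hI hj hv, hdf, diff_eq_of_mem_eigenDist hO hI hT j hv]
    simp only [f]
    field_simp
    ring
  have hXf : (fun q => diff E f q (X q)) = fun _ => 0 := funext fun q => hdfi q _ (hX.2 q)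
  -- Differentiate `f⟨H, Z⟩ = -½ Z(f)` along `X`: since `X(f) = 0` identically, `XZ(f) = [X, Z](f)`.
  have e1 : f p * diff E (fun q => g.val q (H q) (Z q)) p (X p) =
      -(1 / 2) * diff E f p (VectorField.mlieBracket 𝓘(ℝ, E) X Z p) := by
    have m1 := mvfderiv_mul (hf.mdifferentiable (by simp) p)
      (mdifferentiableAt_metric (g := g) dH dZ)
    have hZf : MDifferentiableAt 𝓘(ℝ, E) 𝓘(ℝ, ℝ) (fun q => diff E f q (Z q)) p :=
      (contMDiffAt_mvfderiv_apply (hf p) (hZ.1 p)).mdifferentiableAt (by simp)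
    have m2 := mvfderiv_mul (mdifferentiableAt_const (c := -(1 / 2 : ℝ))) hZf
    have m3 : (f * fun q => g.val q (H q) (Z q)) =
        (fun _ => -(1 / 2 : ℝ)) * fun q => diff E f q (Z q) :=
      funext fun q => hfH q _ (hZ.2 q)
    rw [m3, m2] at m1
    have m4 := DFunLike.congr_fun m1 (X p)
    rw [mvfderiv_const] at m4
    have e3 := mvfderiv_mlieBracket (hf p)
      ((contMDiffAt_mvfderiv_apply (hf p) (hX.1 p)).mdifferentiableAt (by simp)) hZf dX dZ
    have hXf' : mvfderiv 𝓘(ℝ, E) (fun q => mvfderiv 𝓘(ℝ, E) f q (X q)) p = 0 := by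
      have := congrArg (fun u => mvfderiv 𝓘(ℝ, E) u p) hXf
      simpa only [mvfderiv_const] using this
    rw [hXf', zero_apply, sub_zero] at e3
    have hXp := hdfi p _ (hX.2 p)
    simp only [add_apply, smul_apply, smul_eq_mul, zero_apply, mul_zero, add_zero, diff]
      at m4 hXp ⊢
    rw [e3, m4, hXp]
    ring
  -- The bracket lies in `E_i ⊕ E_j`: on the `E_j` part this is `hfH`, and on the `E_i` part both
  -- sides vanish.
  have e2 : f p * g.val p (H p) (VectorField.mlieBracket 𝓘(ℝ, E) X Z p) =
      -(1 / 2) * diff E f p (VectorField.mlieBracket 𝓘(ℝ, E) X Z p) := by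
    rw [← sum_proj hI p (VectorField.mlieBracket 𝓘(ℝ, E) X Z p), map_sum, map_sum, Finset.mul_sum,
      Finset.mul_sum]
    refine Finset.sum_congr rfl fun k _ => ?_
    by_cases hkj : k = j
    · subst hkj
      exact hfH p _ (proj_mem (isNondegenerate_eigenDist hI k) p _)
    by_cases hki : k = i
    · subst hki
      have hm := proj_mem hD p (VectorField.mlieBracket 𝓘(ℝ, E) X Z p)
      rw [hdfi p _ hm, hH, val_meanNormal_self hI hm, mul_zero, mul_zero]
    · rw [proj_mlieBracket_eq_zero hI hki hkj hX hZ p, map_zero, map_zero, mul_zero, mul_zero]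
  -- Both `Z` and `H` are sections of the geodesic distribution `E_i^⊥`, so `⟨∇_Z H, X⟩ = 0`. Hence
  -- `⟨H, ∇_X Z⟩ = ⟨H, [X, Z]⟩`, which cancels `X⟨H, Z⟩` in metric compatibility.
  have e3 : g.val p (H p) (nabla g Z X p) = 0 := by
    have oHX : ∀ q, g.val q (H q) (X q) = 0 := fun q => val_meanNormal_self hI (hX.2 q)
    have h1 := (proj_eq_zero_iff (isNondegenerate_perp (isNondegenerate_perp hD))).1
      (hgeo.secondForm_eq Z H ⟨hZ.1, fun q => eigenDist_le_perp hI hj q (hZ.2 q)⟩ sH p) (X p)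
      (by rw [perp_perp]; exact hX.2 p)
    rw [val_nabla_of_orthogonal dZ dH dX oHX] at h1
    exact neg_eq_zero.1 h1
  have e4 := nabla_metric (g := g) dX dH dZ
  have e5 : g.val p (H p) (nabla g X Z p) =
      g.val p (H p) (VectorField.mlieBracket 𝓘(ℝ, E) X Z p) := by
    rw [← nabla_torsion_free (g := g) dX dZ, map_sub, e3, sub_zero]
  have hfp : f p ≠ 0 := h0
  rw [e5] at e4
  have e6 : f p * g.val p (nabla g X H p) (Z p) = 0 := by
    rw [e4, mul_add, e2] at e1
    linarith
  exact (mul_eq_zero.1 e6).resolve_left hfp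

omit [Fintype ι] in
theorem proj_grad_eq_iff {D : Dist E M} (hD : IsNondegenerate g D) (f : M → ℝ) (p : M) :
    proj g D p (g.grad f p) = proj g D p (t p) ↔ ∀ z ∈ D p, diff E f p z = g.val p (t p) z := by
  rw [proj_eq_proj_iff hD]
  exact forall₂_congr fun z _ => by rw [val_grad]

theorem diff_eq_zero_of_forall_eigenDist
    (hI : IsOrthogonallyIntegrable g (fun i => eigenDist g T (lam i))) {f : M → ℝ} {p : M}
    (h : ∀ j, ∀ z ∈ eigenDist g T (lam j) p, diff E f p z = 0) : diff E f p = 0 := by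
  have h1 : g.grad f p = 0 := eq_of_forall_eigenDist hI fun j z hz => by
    rw [val_grad, h j z hz, map_zero, zero_apply]
  ext v
  rw [← val_grad (g := g), h1, map_zero, zero_apply]

theorem isGeodesic_eigenDist_iff_isLocallyConstant [T2Space M] (hO : IsOrthogonalTensor g T lam)
    (hI : IsOrthogonallyIntegrable g (fun i => eigenDist g T (lam i)))
    (hT : IsKillingTensor g T) (i : ι) :
    IsGeodesic g (eigenDist g T (lam i)) ↔ IsLocallyConstant (lam i) := by
  rw [isGeodesic_eigenDist_iff hO hI hT]
  simp only [Pi.zero_apply, map_zero, zero_apply]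
  constructor
  · intro h
    refine isLocallyConstant_of_diff_eq_zero (hO.smooth i) fun p =>
      diff_eq_zero_of_forall_eigenDist hI fun j z hz => ?_
    by_cases hj : j = i
    · subst hj
      simpa using diff_eq_of_mem_eigenDist hO hI hT j hz
    · exact h j hj p z hz
  · intro h j _ p z _
    have hp : lam i =ᶠ[𝓝 p] fun _ => lam i p := h.eventually_eq p
    rw [diff, mvfderiv_congr hp, mvfderiv_const, zero_apply]

theorem isKilling_eigenDist_iff_independentOf [T2Space M] (hO : IsOrthogonalTensor g T lam)
    (hI : IsOrthogonallyIntegrable g (fun i => eigenDist g T (lam i)))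
    (hT : IsKillingTensor g T) (i : ι) :
    IsKilling g (eigenDist g T (lam i)) ↔
      ∀ j, IndependentOf (lam j) (eigenDist g T (lam i)) := by
  rw [isKilling_eigenDist_iff hO hI hT]
  simp only [Pi.zero_apply, map_zero, zero_apply]
  constructor
  · intro h j p z hz
    by_cases hj : j = i
    · subst hj
      simpa using diff_eq_of_mem_eigenDist hO hI hT j hz
    · exact h j hj p z hz
  · exact fun h j _ p z hz => h j p z hz

end Spherical

end PseudoRiemannian

theorem mainTheorem6
    {E : Type*} [NormedAddCommGroup E] [NormedSpace ℝ E] [FiniteDimensional ℝ E]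
    {M : Type*} [TopologicalSpace M] [T2Space M] [ChartedSpace E M] [IsManifold 𝓘(ℝ, E) ∞ M]
    (g : PseudoRiemannian.Metric E M) (T : PseudoRiemannian.SymTensor E M)
    {ι : Type*} [Fintype ι] (lam : ι → M → ℝ)
    (hT : PseudoRiemannian.IsOrthogonalTensor g T lam)
    (hint : PseudoRiemannian.IsOrthogonallyIntegrable g
      (fun i => PseudoRiemannian.eigenDist g T (lam i))) :
    (∀ t : ∀ p : M, PseudoRiemannian.Tan E p, PseudoRiemannian.IsConformalKilling g T t →
      ∀ i,
        (PseudoRiemannian.IsKilling g (PseudoRiemannian.eigenDist g T (lam i)) ↔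
          ∀ j, j ≠ i → ∀ p,
            PseudoRiemannian.proj g (PseudoRiemannian.eigenDist g T (lam i)) p (g.grad (lam j) p) =
              PseudoRiemannian.proj g (PseudoRiemannian.eigenDist g T (lam i)) p (t p)) ∧
        (PseudoRiemannian.IsGeodesic g (PseudoRiemannian.eigenDist g T (lam i)) ↔
          ∀ j, j ≠ i → ∀ p,
            PseudoRiemannian.proj g (PseudoRiemannian.eigenDist g T (lam j)) p (g.grad (lam i) p) =
              PseudoRiemannian.proj g (PseudoRiemannian.eigenDist g T (lam j)) p (t p))) ∧
    (PseudoRiemannian.IsKillingTensor g T →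
      ∀ i,
        (PseudoRiemannian.IsKilling g (PseudoRiemannian.eigenDist g T (lam i)) ↔
          ∀ j, PseudoRiemannian.IndependentOf (lam j)
            (PseudoRiemannian.eigenDist g T (lam i))) ∧
        (PseudoRiemannian.IsGeodesic g (PseudoRiemannian.eigenDist g T (lam i)) ↔
          IsLocallyConstant (lam i)) ∧
        (PreconnectedSpace M →
          (PseudoRiemannian.IsGeodesic g (PseudoRiemannian.eigenDist g T (lam i)) ↔
            ∃ c : ℝ, ∀ p, lam i p = c))) := by
  refine ⟨fun t ht i => ⟨?_, ?_⟩, fun hK i => ⟨?_, ?_, fun hM => ?_⟩⟩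
  · rw [PseudoRiemannian.isKilling_eigenDist_iff hT hint ht]
    exact forall₃_congr fun j _ p =>
      (PseudoRiemannian.proj_grad_eq_iff (hint.nondegenerate i) (lam j) p).symm
  · rw [PseudoRiemannian.isGeodesic_eigenDist_iff hT hint ht]
    exact forall₃_congr fun j _ p =>
      (PseudoRiemannian.proj_grad_eq_iff (hint.nondegenerate j) (lam i) p).symm
  · exact PseudoRiemannian.isKilling_eigenDist_iff_independentOf hT hint hK i
  · exact PseudoRiemannian.isGeodesic_eigenDist_iff_isLocallyConstant hT hint hK i
  · rw [PseudoRiemannian.isGeodesic_eigenDist_iff_isLocallyConstant hT hint hK i]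
    exact ⟨fun h => h.exists_eq_const.imp fun c hc p => congrFun hc p,
      fun ⟨c, hc⟩ => IsLocallyConstant.of_constant _ fun x y => (hc x).trans (hc y).symm⟩
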